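/- **Theorem 2.** Let $N\ge 0$, $T\ge 0$, let $\widehat\Omega\subset\mathbb R^2$ be a fixed polygonal (closed) reference domain and let $\boldsymbol x=X(\widehat{\boldsymbol x},\tau)$ be a mesh motion that is of class $C^{N+3}$ on a neighbourhood of $\widehat\Omega\times[0,T]$ with $\det(\partial X/\partial\widehat{\boldsymbol x})>0$ on $\widehat\Omega\times[0,T]$. Put $J\widehat{\boldsymbol x}_t=\det(\partial X/\partial\widehat{\boldsymbol x})\,\widehat{\boldsymbol x}_t$, where $\widehat{\boldsymbol x}_t=-(\partial X/\partial\widehat{\boldsymbol x})^{-1}\,\partial X/\partial\tau$ is the time derivative of the reference coordinates at a fixed physical point; this field is given by $X$. The equation $du/dt=0$ is discretized on a conforming triangulation $\widehat\Omega=\bigcup_k D^k$ of mesh size $h=\max_k\operatorname{diam}D^k$ as follows. The evolved unknowns are two functions, written $uJ$ and (the discrete Jacobian) $J$, which on every $D^k$ are polynomials of degree at most $N$ in space, continuous in time on $[0,T]$ and differentiable on $(0,T)$, with $J>0$; the discrete solution is $u=\Pi_N\tilde u$ with $\tilde u=(uJ)/J$, where $\Pi_N$ is the $L^2(D^k)$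 projection onto the polynomials $P^N(D^k)$ of degree at most $N$ on each $D^k$. For all $0<\tau<T$, all $k$ and all $v,w\in P^N(D^k)$, $$\Big(\tfrac{\partial (uJ)}{\partial\tau},v\Big)_{L^2(D^k)}+\tfrac12\big\langle u^+J\widehat{\boldsymbol x}_t\cdot\boldsymbol n,v\big\rangle_{L^2(\partial D^k)}+\tfrac12\Big\{\big(\widehat\nabla\cdot(J\widehat{\boldsymbol x}_t)u,v\big)_{L^2(D^k)}+\big(J\widehat{\boldsymbol x}_t\cdot\widehat\nabla u,v\big)_{L^2(D^k)}-\big(uJ\widehat{\boldsymbol x}_t,\widehat\nabla v\big)_{L^2(D^k)}\Big\}=0,$$ $$\Big(\tfrac{\partial J}{\partial\tau},w\Big)_{L^2(D^k)}+\big(\widehat\nabla\cdot(J\widehat{\boldsymbol x}_t),w\big)_{L^2(D^k)}=0,$$ where $\boldsymbol n$ is the outward unit normal, $u^+$ is the trace of $u$ from the neighbouring element on interior edges and a given continuous exterior trace on each boundary edge, and at every boundary point $u=0$ or $u^+=0$ or $J\widehat{\boldsymbol x}_t\cdot\boldsymbol n=0$. Let $\|uJ\|_{1/J}^2=\sum_k\big((uJ)/J,\,uJ\big)_{L^2(D^k)}$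 (with the discrete $J$), and let $\|\cdot\|_{H^{N+1}(\widehat\Omega_h)}$ be the broken Sobolev norm over the elements. Then $$\Big|\,\|uJ(\cdot,T)\|_{1/J}^2-\|uJ(\cdot,0)\|_{1/J}^2\Big|\le C\,h^{2N+2}$$ for sufficiently regular solutions, in each of the following two senses. 1. If $\max_{t\in[0,T]}\|\tilde u(\cdot,t)\|_{H^{N+1}(\widehat\Omega_h)}\le M$, the estimate holds with a constant $C$ that depends only on $N$, $T$, $\widehat\Omega$, $X$ and $M$. 2. If $\max_{t\in[0,T]}\|u(\cdot,t)\|_{H^{N+1}(\widehat\Omega_h)}\le M$ and, on every element and for all $t\in[0,T]$, the discrete Jacobian satisfies $J\ge c>0$ and has spatial derivatives of orders $0,\dots,N+1$ bounded by $R$, the estimate holds with a constant $C$ that depends only on $N$, $T$, $\widehat\Omega$, $X$, $M$, $c$ and $R$. In particular $C$ does not depend on the triangulation, on $h$, or on the discrete solution. -/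

import Mathlib

open Set MeasureTheory

namespace ALEDG

noncomputable section

/-- The plane with its Euclidean structure and Lebesgue measure. -/
abbrev Plane := EuclideanSpace ℝ (Fin 2)

/-! ### Triangulations -/

/-- A conforming triangulation of the closed set `Ω` by `K` non-overlapping,
non-degenerate closed triangles. -/
structure Triangulation (Ω : Set Plane) where
  /-- number of elements -/
  K : ℕ
  /-- vertices of the elements -/
  vert : Fin K → Fin 3 → Plane
  nondegenerate : ∀ k, AffineIndependent ℝ (vert k)
  covers : (⋃ k, convexHull ℝ (range (vert k))) = Ω
  nonoverlapping : ∀ k l, k ≠ l →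
    Disjoint (interior (convexHull ℝ (range (vert k)))) (interior (convexHull ℝ (range (vert l))))
  conforming : ∀ k l, k ≠ l →
    convexHull ℝ (range (vert k)) ∩ convexHull ℝ (range (vert l)) =
      convexHull ℝ (range (vert k) ∩ range (vert l))

namespace Triangulation

variable {Ω : Set Plane} (𝒯 : Triangulation Ω)

/-- The `k`-th element, a closed triangle. -/
def elem (k : Fin 𝒯.K) : Set Plane := convexHull ℝ (range (𝒯.vert k))

/-- The mesh size: the largest element diameter. -/
def size : ℝ := ⨆ k, Metric.diam (𝒯.elem k)

/-- First endpoint of the `i`-th edge (the one opposite to vertex `i`). -/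
def edgeStart (k : Fin 𝒯.K) (i : Fin 3) : Plane := 𝒯.vert k (i + 1)

/-- Second endpoint of the `i`-th edge. -/
def edgeEnd (k : Fin 𝒯.K) (i : Fin 3) : Plane := 𝒯.vert k (i + 2)

/-- The `i`-th edge of the `k`-th element. -/
def edge (k : Fin 𝒯.K) (i : Fin 3) : Set Plane := segment ℝ (𝒯.edgeStart k i) (𝒯.edgeEnd k i)

/-- Element `l` is the neighbour of element `k` across the `i`-th edge of element `k`. -/
def IsNeighbor (k : Fin 𝒯.K) (i : Fin 3) (l : Fin 𝒯.K) : Prop :=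
  l ≠ k ∧ ∃ j, 𝒯.edge l j = 𝒯.edge k i

/-- The edge vector rotated by a right angle. -/
def edgePerp (k : Fin 𝒯.K) (i : Fin 3) : Plane :=
  !₂[(𝒯.edgeEnd k i - 𝒯.edgeStart k i) 1, -(𝒯.edgeEnd k i - 𝒯.edgeStart k i) 0]

/-- Outward unit normal on the `i`-th edge: perpendicular to the edge and pointing away from the
opposite vertex. -/
def normal (k : Fin 𝒯.K) (i : Fin 3) : Plane :=
  (-SignType.sign (inner ℝ (𝒯.edgePerp k i) (𝒯.vert k i - 𝒯.edgeStart k i)) : ℝ) •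
    ((‖𝒯.edgeEnd k i - 𝒯.edgeStart k i‖)⁻¹ • 𝒯.edgePerp k i)

/-- Arc-length integral over the `i`-th edge. -/
def edgeIntegral (k : Fin 𝒯.K) (i : Fin 3) (f : Plane → ℝ) : ℝ :=
  ‖𝒯.edgeEnd k i - 𝒯.edgeStart k i‖ *
    ∫ s in (0 : ℝ)..1, f (AffineMap.lineMap (𝒯.edgeStart k i) (𝒯.edgeEnd k i) s)

/-- The broken Sobolev norm of order `m` of a function given element by element,
`‖f‖² = ∑ₖ ∑_{j ≤ m} ∫_{Dᵏ} |Dʲ f|²`, for functions that are smooth on each element. -/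
def sobolevNorm (m : ℕ) (f : Fin 𝒯.K → Plane → ℝ) : ℝ :=
  Real.sqrt (∑ k, ∑ j ∈ Finset.range (m + 1),
    ∫ x in 𝒯.elem k, ‖iteratedFDeriv ℝ j (f k) x‖ ^ 2)

/-- The energy `‖q‖²_{1/J} = ((q / J), q)_{L²(Ω)}` of an elementwise given `q`. -/
def energy (q J : Fin 𝒯.K → Plane → ℝ) : ℝ :=
  ∑ k, ∫ x in 𝒯.elem k, q k x / J k x * q k x

end Triangulation

/-- Polynomial functions on the plane of total degree at most `N`. -/
def IsPoly (N : ℕ) (f : Plane → ℝ) : Prop :=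
  ∃ p : MvPolynomial (Fin 2) ℝ, p.totalDegree ≤ N ∧ ∀ x, f x = MvPolynomial.eval (fun i => x i) p

/-! ### Mesh motion

The physical position at time `t` of the reference point `x` is `X t x`. -/

/-- Jacobian determinant of the mesh motion (the space-time Jacobian matrix has last row
`(0, 0, 1)`, hence the same determinant as the spatial one). -/
def jacobian (X : ℝ → Plane → Plane) (t : ℝ) (x : Plane) : ℝ := (fderiv ℝ (X t) x).det

/-- The time derivative `∂ξ/∂t` of the reference coordinates at a fixed physical point. By the
chain rule it is `-(∂X/∂ξ)⁻¹ ∂X/∂τ`. -/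
def refVelocity (X : ℝ → Plane → Plane) (t : ℝ) (x : Plane) : Plane :=
  -((fderiv ℝ (X t) x).inverse (deriv (fun s => X s x) t))

/-- The vector field `J ∂ξ/∂t` of the mesh motion. -/
def meshFlux (X : ℝ → Plane → Plane) (t : ℝ) (x : Plane) : Plane :=
  jacobian X t x • refVelocity X t x

/-- Divergence of a planar vector field. -/
def divergence (b : Plane → Plane) (x : Plane) : ℝ :=
  ∑ i, (fderiv ℝ b x (EuclideanSpace.single i 1)) i

/-! ### The scheme -/

/-- `(q, J, u)` is a solution on `[0, T]` of the semi-discrete skew-symmetric formulation of degree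
`N` with the weight-adjusted definition of `u`. Here `q` is the evolved variable `uJ`, `J` is the
evolved (discrete) Jacobian, and `uext k i t` is the exterior trace `u⁺` of `u` on the `i`-th edge
of element `k`. -/
structure IsWADGSolution {Ω : Set Plane} (𝒯 : Triangulation Ω) (N : ℕ) (X : ℝ → Plane → Plane)
    (T : ℝ) (q J u : Fin 𝒯.K → ℝ → Plane → ℝ)
    (uext : Fin 𝒯.K → Fin 3 → ℝ → Plane → ℝ) : Prop where
  poly_q : ∀ k, ∀ t ∈ Icc 0 T, IsPoly N (q k t)
  poly_J : ∀ k, ∀ t ∈ Icc 0 T, IsPoly N (J k t)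
  poly_u : ∀ k, ∀ t ∈ Icc 0 T, IsPoly N (u k t)
  J_pos : ∀ k, ∀ t ∈ Icc 0 T, ∀ x ∈ 𝒯.elem k, 0 < J k t x
  continuous_q : ∀ k x, ContinuousOn (fun t => q k t x) (Icc 0 T)
  continuous_J : ∀ k x, ContinuousOn (fun t => J k t x) (Icc 0 T)
  differentiable_q : ∀ k x, ∀ t ∈ Ioo 0 T, DifferentiableAt ℝ (fun s => q k s x) t
  differentiable_J : ∀ k x, ∀ t ∈ Ioo 0 T, DifferentiableAt ℝ (fun s => J k s x) t
  /-- `u` is the `L²` projection of `q / J` onto polynomials of degree `N`. -/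
  projection : ∀ k, ∀ t ∈ Icc 0 T, ∀ v, IsPoly N v →
    ∫ x in 𝒯.elem k, u k t x * v x = ∫ x in 𝒯.elem k, q k t x / J k t x * v x
  /-- Interior edges: the exterior trace is the trace of the neighbour. -/
  trace_interior : ∀ k i, ∀ t ∈ Ioo 0 T, ∀ l, 𝒯.IsNeighbor k i l →
    ∀ x ∈ 𝒯.edge k i, uext k i t x = u l t x
  trace_continuous : ∀ k i, ∀ t ∈ Ioo 0 T, ContinuousOn (uext k i t) (𝒯.edge k i)
  /-- Boundary edges: the homogeneous condition `u = 0`, imposed through the interior or the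
  exterior trace, wherever the mesh flux crosses the boundary. -/
  boundary : ∀ k i, ∀ t ∈ Ioo 0 T, (∀ l, ¬ 𝒯.IsNeighbor k i l) → ∀ x ∈ 𝒯.edge k i,
    u k t x = 0 ∨ uext k i t x = 0 ∨ inner ℝ (meshFlux X t x) (𝒯.normal k i) = 0
  /-- The skew-symmetric equation for `q = uJ`. -/
  eq_q : ∀ k, ∀ t ∈ Ioo 0 T, ∀ v, IsPoly N v →
    (∫ x in 𝒯.elem k, deriv (fun s => q k s x) t * v x)
      + 1 / 2 * ∑ i, 𝒯.edgeIntegral k i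
          (fun x => uext k i t x * inner ℝ (meshFlux X t x) (𝒯.normal k i) * v x)
      + 1 / 2 * ((∫ x in 𝒯.elem k, divergence (meshFlux X t) x * u k t x * v x)
          + (∫ x in 𝒯.elem k, inner ℝ (meshFlux X t x) (gradient (u k t) x) * v x)
          - ∫ x in 𝒯.elem k, u k t x * inner ℝ (meshFlux X t x) (gradient v x)) = 0
  /-- The discrete geometric conservation law. -/
  eq_J : ∀ k, ∀ t ∈ Ioo 0 T, ∀ w, IsPoly N w →
    (∫ x in 𝒯.elem k, deriv (fun s => J k s x) t * w x)
      + ∫ x in 𝒯.elem k, divergence (meshFlux X t) x * w x = 0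

end

end ALEDG

open ALEDG

open Set MeasureTheory

namespace ALEDG

noncomputable section

/-! ### Polynomial functions -/

namespace IsPoly

variable {N m : ℕ} {f g : Plane → ℝ}

/-! Write `ũ = q / J`, `b` for the mesh flux, `g = div b`, `e = ∂J/∂τ + g` for the residual of the
discrete conservation law, and `w = ũ - u`. The energy `∑ ∫ q²/J` has derivative `∑ ∫ (2 ũ ∂q/∂τ -
ũ² ∂J/∂τ)`. Since `∂q/∂τ` is again in `P^N`, the projection replaces `ũ` by `u` in the first term.
Testing the scheme with `v = u` then cancels the skew-symmetric volume terms, and the edge terms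
cancel in pairs (`sum_edgeIntegral_flux_eq_zero`). What remains is `-∑ ∫ (e ũ² - g (ũ² - u²))`
(`hasDerivAt_energy`).

Both remaining terms are products of two quantities of order `h^(N+1)`. The residual `e` is
orthogonal to `P^N` and pointwise `O(h^(N+1))` (`exists_residual_bound`), and orthogonality allows a
polynomial approximation of the squared solution to be subtracted from it. Likewise `w` is
orthogonal to `P^N` and `O(h^(N+1))` in `L²`, and `ũ² - u²` is linear in `w` up to a multiple of
`w²`. A polynomial approximation of `g a` can therefore be subtracted in the linear part
(`abs_integral_production_le`). Here `a` is the function with bounded Sobolev norm: `ũ` in the first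
statement, `u` in the second. The two cases differ only in three coefficients `α`, `β`, `γ` and in
the bound for `w` (`integral_sq_le_of_orthogonal`, `integral_sq_le_of_weighted_orthogonal`).

No shape regularity enters. Polynomial approximation uses only convexity and the diameter
(`exists_isPoly_integral_pow_le`), and the sup-norm stability of the `L²` projection is affine
invariant (`exists_bound_of_orthogonal`). The mean value theorem in time finishes the argument. -/

theorem mono (hf : IsPoly N f) (h : N ≤ m) : IsPoly m f := by
  obtain ⟨p, hp, hpf⟩ := hf
  exact ⟨p, hp.trans h, hpf⟩

theorem const (c : ℝ) : IsPoly N fun _ => c :=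
  ⟨MvPolynomial.C c, by simp, by simp⟩

theorem coord (i : Fin 2) : IsPoly 1 fun x => x i :=
  ⟨MvPolynomial.X i, by simp, by simp⟩

theorem add (hf : IsPoly N f) (hg : IsPoly N g) : IsPoly N fun x => f x + g x := by
  obtain ⟨p, hp, hpf⟩ := hf
  obtain ⟨r, hr, hrg⟩ := hg
  exact ⟨p + r, (MvPolynomial.totalDegree_add _ _).trans (max_le hp hr), by simp [hpf, hrg]⟩

theorem mul (hf : IsPoly N f) (hg : IsPoly m g) : IsPoly (N + m) fun x => f x * g x := by
  obtain ⟨p, hp, hpf⟩ := hf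
  obtain ⟨r, hr, hrg⟩ := hg
  exact ⟨p * r, (MvPolynomial.totalDegree_mul _ _).trans (add_le_add hp hr), by simp [hpf, hrg]⟩

theorem const_mul (c : ℝ) (hf : IsPoly N f) : IsPoly N fun x => c * f x := by
  simpa using (const (N := 0) c).mul hf

theorem sub (hf : IsPoly N f) (hg : IsPoly N g) : IsPoly N fun x => f x - g x := by
  simpa [sub_eq_add_neg] using hf.add (hg.const_mul (-1))

theorem sum {ι : Type*} {s : Finset ι} {F : ι → Plane → ℝ} (h : ∀ i ∈ s, IsPoly N (F i)) :
    IsPoly N fun x => ∑ i ∈ s, F i x := by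
  classical
  induction s using Finset.induction_on with
  | empty => simpa using const 0
  | insert a s ha ih =>
    simp only [Finset.sum_insert ha]
    exact (h a (by simp)).add (ih fun i hi => h i (by simp [hi]))

theorem prod {ι : Type*} {s : Finset ι} {d : ι → ℕ} {F : ι → Plane → ℝ}
    (h : ∀ i ∈ s, IsPoly (d i) (F i)) : IsPoly (∑ i ∈ s, d i) fun x => ∏ i ∈ s, F i x := by
  classical
  induction s using Finset.induction_on with
  | empty => simpa using const 1
  | insert a s ha ih =>
    simp only [Finset.sum_insert ha, Finset.prod_insert ha]
    exact (h a (by simp)).mul (ih fun i hi => h i (by simp [hi]))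

theorem pow (hf : IsPoly N f) (n : ℕ) : IsPoly (n * N) fun x => f x ^ n := by
  simpa using prod (s := Finset.range n) (d := fun _ => N) (F := fun _ => f) fun _ _ => hf

theorem comp_of_coord {A : Plane → Plane} (hf : IsPoly N f)
    (hA : ∀ i, IsPoly 1 fun x => A x i) : IsPoly N fun x => f (A x) := by
  obtain ⟨p, hp, hpf⟩ := hf
  simp only [hpf, MvPolynomial.eval_eq']
  refine sum fun d hd => const_mul _ ?_
  have h := prod (s := Finset.univ) (d := fun i => d i * 1) fun i _ => (hA i).pow (d i)
  refine h.mono (le_trans ?_ hp)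
  refine le_trans (le_of_eq ?_) (MvPolynomial.le_totalDegree hd)
  simp [Finsupp.sum_fintype]

theorem contDiff (hf : IsPoly N f) : ContDiff ℝ ⊤ f := by
  obtain ⟨p, -, hpf⟩ := hf
  have : f = fun x : Plane => ∑ d ∈ p.support, p.coeff d * ∏ i, x i ^ d i := by
    funext x; rw [hpf, MvPolynomial.eval_eq']
  rw [this]
  fun_prop

theorem contDiff_nat (hf : IsPoly N f) (n : ℕ) : ContDiff ℝ n f := hf.contDiff.of_le le_top

theorem continuous (hf : IsPoly N f) : Continuous f := hf.contDiff.continuous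

theorem eq_zero_of_isOpen (hf : IsPoly N f) {V : Set Plane} (hV : IsOpen V) (hne : V.Nonempty)
    (h0 : ∀ x ∈ V, f x = 0) : f = fun _ => 0 := by
  obtain ⟨p, -, hpf⟩ := hf
  obtain ⟨x₀, hx₀⟩ := hne
  have hV' : IsOpen ((WithLp.toLp 2 : (Fin 2 → ℝ) → Plane) ⁻¹' V) :=
    hV.preimage (PiLp.continuous_toLp 2 _)
  -- In the sup norm a ball is a product of intervals, and a polynomial vanishing on a product of
  -- infinite sets is zero.
  obtain ⟨ε, hε, hball⟩ := Metric.isOpen_iff.1 hV' (WithLp.ofLp x₀) (by simpa using hx₀)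
  have hp : p = 0 := by
    refine MvPolynomial.funext_set (fun i => Metric.ball (x₀ i) ε) (fun i => ?_) fun y hy => ?_
    · rw [Real.ball_eq_Ioo]
      exact Ioo_infinite (by linarith)
    · have hy' : WithLp.toLp 2 y ∈ V := by
        apply hball
        rw [ball_pi _ hε]
        exact hy
      have := h0 _ hy'
      rw [hpf] at this
      simpa using this
  funext x
  simp [hpf, hp]

end IsPoly

/-- The space of polynomial functions of total degree at most `N`. -/
def polySpace (N : ℕ) : Submodule ℝ (Plane → ℝ) where
  carrier := {f | IsPoly N f}
  add_mem' := IsPoly.add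
  zero_mem' := IsPoly.const 0
  smul_mem' := fun c _ hf => hf.const_mul c

theorem mem_polySpace {N : ℕ} {f : Plane → ℝ} : f ∈ polySpace N ↔ IsPoly N f := Iff.rfl

instance (N : ℕ) : FiniteDimensional ℝ (polySpace N) := by
  let φ : MvPolynomial (Fin 2) ℝ →ₗ[ℝ] (Plane → ℝ) :=
    { toFun := fun p x => MvPolynomial.eval (fun i => x i) p
      map_add' := fun p q => by funext x; simp
      map_smul' := fun c p => by funext x; simp [MvPolynomial.smul_eval] }
  have : polySpace N = (MvPolynomial.restrictTotalDegree (Fin 2) ℝ N).map φ := by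
    ext f
    simp only [mem_polySpace, Submodule.mem_map, MvPolynomial.mem_restrictTotalDegree, IsPoly]
    refine exists_congr fun p => and_congr_right fun _ => ?_
    rw [eq_comm, funext_iff]
    rfl
  rw [this]
  infer_instance

/-- Polynomials of bounded degree are determined linearly by their values at finitely many
points. -/
theorem exists_interpolation (N : ℕ) : ∃ (S : Finset Plane) (L : Plane → Plane → ℝ),
    (∀ p, IsPoly N (L p)) ∧ ∀ f, IsPoly N f → ∀ x, f x = ∑ p ∈ S, f p * L p x := by
  classical
  let ev : Plane → Module.Dual ℝ (polySpace N) := fun x =>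
    (LinearMap.proj x).comp (polySpace N).subtype
  -- A polynomial killed by every evaluation is zero, so in finite dimension the evaluations span
  -- the dual. Each coordinate functional is then a finite combination of point values.
  have hspan : Submodule.span ℝ (range ev) = ⊤ := by
    refine Submodule.span_eq_top_of_ne_zero fun z hz => ?_
    by_contra! h
    apply hz
    ext x
    exact h (ev x) ⟨x, rfl⟩
  let b := Module.finBasis ℝ (polySpace N)
  have hc : ∀ i, ∃ c : Plane →₀ ℝ, (c.sum fun x a => a • ev x) = b.coord i := fun i =>
    Finsupp.mem_span_range_iff_exists_finsupp.1 (by rw [hspan]; trivial)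
  choose c hc using hc
  refine ⟨Finset.univ.biUnion fun i => (c i).support,
    fun p x => ∑ i, c i p * (b i : Plane → ℝ) x,
    fun p => IsPoly.sum fun i _ => (b i).2.const_mul _, fun f hf x => ?_⟩
  let F : polySpace N := ⟨f, hf⟩
  have h1 : f x = ∑ i, b.coord i F * (b i : Plane → ℝ) x := by
    refine (congrFun (congrArg Subtype.val (b.sum_repr F)) x).symm.trans ?_
    simp only [Submodule.coe_sum, Submodule.coe_smul, Finset.sum_apply, Pi.smul_apply,
      smul_eq_mul, Module.Basis.coord_apply]
  have h2 : ∀ i, b.coord i F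
      = ∑ p ∈ Finset.univ.biUnion fun i => (c i).support, c i p * f p := by
    intro i
    rw [← hc i, Finsupp.sum_of_support_subset (s := Finset.univ.biUnion fun i => (c i).support)]
    · simp [LinearMap.sum_apply, ev, F]
    · exact Finset.subset_biUnion_of_mem (fun i => (c i).support) (Finset.mem_univ i)
    · simp
  rw [h1]
  simp_rw [h2, Finset.sum_mul, Finset.mul_sum]
  rw [Finset.sum_comm]
  refine Finset.sum_congr rfl fun p _ => Finset.sum_congr rfl fun i _ => by ring

/-! ### Taylor polynomials and the Bramble–Hilbert estimate on convex sets -/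

open scoped Nat ENNReal

/-- Taylor polynomial of degree `N` of `f` about `y`. -/
def taylorPoly (N : ℕ) (f : Plane → ℝ) (y x : Plane) : ℝ :=
  ∑ k ∈ Finset.range (N + 1), (k ! : ℝ)⁻¹ * iteratedFDeriv ℝ k f y fun _ => x - y

theorem isPoly_multilinear {k : ℕ} (A : ContinuousMultilinearMap ℝ (fun _ : Fin k => Plane) ℝ)
    (y : Plane) : IsPoly k fun x => A fun _ => x - y := by
  have h : ∀ x : Plane, (A fun _ => x - y)
      = ∑ r : Fin k → Fin 2, (∏ i, (x - y) (r i)) * A fun i => EuclideanSpace.single (r i) 1 := by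
    intro x
    have hx : x - y = ∑ j : Fin 2, (x - y) j • (EuclideanSpace.single j (1 : ℝ) : Plane) := by
      ext i
      fin_cases i <;> simp
    conv_lhs => rw [hx]
    rw [A.map_sum]
    refine Finset.sum_congr rfl fun r _ => ?_
    rw [A.map_smul_univ]
    rfl
  simp only [h]
  refine IsPoly.sum fun r _ => ?_
  have h1 : ∀ i : Fin 2, IsPoly 1 fun x : Plane => (x - y) i := fun i =>
    (IsPoly.coord i).sub (IsPoly.const (y i))
  have h2 := IsPoly.prod (s := Finset.univ) (d := fun _ : Fin k => 1) fun i _ => h1 (r i)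
  have h3 := h2.mul (IsPoly.const (N := 0) (A fun i => EuclideanSpace.single (r i) 1))
  simpa using h3

theorem isPoly_taylorPoly (N : ℕ) (f : Plane → ℝ) (y : Plane) : IsPoly N (taylorPoly N f y) :=
  IsPoly.sum fun _ hk => ((isPoly_multilinear _ y).const_mul _).mono
    (Nat.lt_succ_iff.1 (Finset.mem_range.1 hk))

section Remainder

variable {N : ℕ} {D : Set Plane} {f : Plane → ℝ} {h : ℝ}

theorem continuousOn_iteratedFDeriv {j n : ℕ} (hjn : j ≤ n)
    (hf : ∀ x ∈ D, ContDiffAt ℝ n f x) : ContinuousOn (iteratedFDeriv ℝ j f) D := fun x hx =>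
  ((hf x hx).iteratedFDeriv_right (m := 0) (i := j)
    (by simpa using hjn)).continuousAt.continuousWithinAt

theorem continuousOn_norm_iteratedFDeriv_pow {j n : ℕ} (hjn : j ≤ n) (p : ℕ)
    (hf : ∀ x ∈ D, ContDiffAt ℝ n f x) :
    ContinuousOn (fun x => ‖iteratedFDeriv ℝ j f x‖ ^ p) D :=
  (continuousOn_iteratedFDeriv hjn hf).norm.pow p

theorem add_smul_sub_mem (hc : Convex ℝ D) {x y : Plane} (hx : x ∈ D) (hy : y ∈ D) {t : ℝ}
    (ht : t ∈ Icc (0 : ℝ) 1) : y + t • (x - y) ∈ D := by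
  have := hc hy hx (sub_nonneg.2 ht.2) ht.1 (by ring)
  convert this using 1
  module

theorem abs_sub_taylorPoly_le (hc : Convex ℝ D) (hf : ∀ x ∈ D, ContDiffAt ℝ (N + 1 : ℕ) f x)
    {x y : Plane} (hx : x ∈ D) (hy : y ∈ D) (hxy : ‖x - y‖ ≤ h) :
    |f x - taylorPoly N f y x|
      ≤ h ^ (N + 1) * ∫ t in (0 : ℝ)..1, ‖iteratedFDeriv ℝ (N + 1) f (y + t • (x - y))‖ := by
  have hh : 0 ≤ h := (norm_nonneg _).trans hxy
  have htay := map_add_eq_sum_add_integral_iteratedFDeriv (f := f) (x := y) (y := x - y) (n := N)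
    fun t ht => by simpa using hf _ (add_smul_sub_mem hc hx hy ht)
  have hcont : ContinuousOn (fun t : ℝ => iteratedFDeriv ℝ (N + 1) f (y + t • (x - y)))
      (uIcc 0 1) := by
    rw [uIcc_of_le zero_le_one]
    exact (continuousOn_iteratedFDeriv le_rfl hf).comp (by fun_prop)
      fun t ht => add_smul_sub_mem hc hx hy ht
  have heq : f x - taylorPoly N f y x = (N ! : ℝ)⁻¹ • ∫ t in (0 : ℝ)..1,
      (1 - t) ^ N • iteratedFDeriv ℝ (N + 1) f (y + t • (x - y)) (fun _ ↦ x - y) := by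
    rw [add_sub_cancel] at htay
    rw [htay]
    simp [taylorPoly]
  rw [heq, smul_eq_mul, abs_mul, ← intervalIntegral.integral_const_mul]
  have h1 : |(N ! : ℝ)⁻¹| ≤ 1 := by
    rw [abs_of_nonneg (by positivity)]
    exact inv_le_one_of_one_le₀ (by exact_mod_cast Nat.one_le_iff_ne_zero.2 (Nat.factorial_ne_zero N))
  refine (mul_le_of_le_one_left (abs_nonneg _) h1).trans ?_
  refine (intervalIntegral.abs_integral_le_integral_abs zero_le_one).trans ?_
  have hint : ContinuousOn (fun t : ℝ => (1 - t) ^ N •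
      iteratedFDeriv ℝ (N + 1) f (y + t • (x - y)) (fun _ ↦ x - y)) (uIcc 0 1) :=
    ContinuousOn.smul (f := fun t : ℝ => (1 - t) ^ N) (Continuous.continuousOn (by fun_prop))
      fun t ht => (hcont t ht).eval_const _
  refine intervalIntegral.integral_mono_on zero_le_one hint.abs.intervalIntegrable
    (hcont.norm.intervalIntegrable.const_mul _) fun t ht => ?_
  rw [smul_eq_mul, abs_mul, abs_of_nonneg (pow_nonneg (sub_nonneg.2 ht.2) _), mul_comm (h ^ _)]
  refine (mul_le_of_le_one_left (abs_nonneg _)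
    (pow_le_one₀ (sub_nonneg.2 ht.2) (by linarith [ht.1]))).trans ?_
  refine ((iteratedFDeriv ℝ (N + 1) f (y + t • (x - y))).le_opNorm _).trans ?_
  simp only [Finset.prod_const, Finset.card_univ, Fintype.card_fin]
  gcongr

theorem abs_sub_taylorPoly_le_of_bound (hc : Convex ℝ D)
    (hf : ∀ x ∈ D, ContDiffAt ℝ (N + 1 : ℕ) f x) {B : ℝ}
    (hB : ∀ x ∈ D, ‖iteratedFDeriv ℝ (N + 1) f x‖ ≤ B)
    {x y : Plane} (hx : x ∈ D) (hy : y ∈ D) (hxy : ‖x - y‖ ≤ h) :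
    |f x - taylorPoly N f y x| ≤ h ^ (N + 1) * B := by
  have hh : 0 ≤ h := (norm_nonneg _).trans hxy
  refine (abs_sub_taylorPoly_le hc hf hx hy hxy).trans ?_
  gcongr
  have hcont : ContinuousOn (fun t : ℝ => ‖iteratedFDeriv ℝ (N + 1) f (y + t • (x - y))‖)
      (uIcc 0 1) := by
    rw [uIcc_of_le zero_le_one]
    exact ((continuousOn_iteratedFDeriv le_rfl hf).comp (by fun_prop)
      fun t ht => add_smul_sub_mem hc hx hy ht).norm
  refine (intervalIntegral.integral_mono_on zero_le_one hcont.intervalIntegrable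
    (intervalIntegrable_const (c := B))
    fun t ht => hB _ (add_smul_sub_mem hc hx hy ht)).trans ?_
  simp

/-- Jensen's inequality for the probability measure on the unit interval. -/
theorem intervalIntegral_pow_le {w : ℝ → ℝ} (hw : ContinuousOn w (uIcc 0 1))
    (h0 : ∀ t ∈ Icc (0 : ℝ) 1, 0 ≤ w t) (p : ℕ) :
    (∫ t in (0 : ℝ)..1, w t) ^ p ≤ ∫ t in (0 : ℝ)..1, w t ^ p := by
  have : IsProbabilityMeasure (volume.restrict (Ioc (0 : ℝ) 1)) := ⟨by simp⟩
  have h1 := hw.intervalIntegrable (μ := volume)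
  have h2 := (hw.pow p).intervalIntegrable (μ := volume)
  rw [intervalIntegrable_iff_integrableOn_Ioc_of_le zero_le_one] at h1 h2
  rw [intervalIntegral.integral_of_le zero_le_one, intervalIntegral.integral_of_le zero_le_one]
  refine (convexOn_pow p).map_integral_le (continuous_pow p).continuousOn isClosed_Ici ?_ h1 h2
  exact (ae_restrict_mem measurableSet_Ioc).mono fun t ht => h0 t (Ioc_subset_Icc_self ht)

/-- The derivative is extended by zero outside `D`, so that the later changes of variables can be
carried out over the whole plane. -/
theorem abs_sub_taylorPoly_pow_le (hc : Convex ℝ D)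
    (hf : ∀ x ∈ D, ContDiffAt ℝ (N + 1 : ℕ) f x)
    {x y : Plane} (hx : x ∈ D) (hy : y ∈ D) (hxy : ‖x - y‖ ≤ h) (p : ℕ) :
    ENNReal.ofReal (|f x - taylorPoly N f y x| ^ p) ≤ ENNReal.ofReal ((h ^ (N + 1)) ^ p) *
      ∫⁻ t in Icc (0 : ℝ) 1, D.indicator
        (fun z => ENNReal.ofReal (‖iteratedFDeriv ℝ (N + 1) f z‖ ^ p)) (y + t • (x - y)) := by
  have hh : 0 ≤ h := (norm_nonneg _).trans hxy
  have hcont : ContinuousOn (fun t : ℝ => ‖iteratedFDeriv ℝ (N + 1) f (y + t • (x - y))‖)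
      (uIcc 0 1) := by
    rw [uIcc_of_le zero_le_one]
    exact ((continuousOn_iteratedFDeriv le_rfl hf).comp (by fun_prop)
      fun t ht => add_smul_sub_mem hc hx hy ht).norm
  have h1 : |f x - taylorPoly N f y x| ^ p ≤ (h ^ (N + 1)) ^ p *
      ∫ t in (0 : ℝ)..1, ‖iteratedFDeriv ℝ (N + 1) f (y + t • (x - y))‖ ^ p := by
    refine (pow_le_pow_left₀ (abs_nonneg _) (abs_sub_taylorPoly_le hc hf hx hy hxy) p).trans ?_
    rw [mul_pow]
    gcongr
    exact intervalIntegral_pow_le hcont (fun t _ => norm_nonneg _) p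
  refine (ENNReal.ofReal_le_ofReal h1).trans ?_
  rw [ENNReal.ofReal_mul (by positivity)]
  gcongr
  have h2 : IntegrableOn (fun t : ℝ => ‖iteratedFDeriv ℝ (N + 1) f (y + t • (x - y))‖ ^ p)
      (Icc 0 1) := by
    rw [← uIcc_of_le zero_le_one]
    exact (hcont.pow p).integrableOn_compact isCompact_uIcc
  rw [intervalIntegral.integral_of_le zero_le_one, ← integral_Icc_eq_integral_Ioc,
    ofReal_integral_eq_lintegral_ofReal h2 (ae_of_all _ fun t => by positivity)]
  refine setLIntegral_mono' measurableSet_Icc fun t ht => ?_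
  rw [indicator_of_mem (add_smul_sub_mem hc hx hy ht)]

/-- Dilation by `r` in the plane costs a factor `r⁻²`, which is at most 4 for `r ≥ 1/2`. -/
theorem lintegral_add_smul {H : Plane → ℝ≥0∞} (hH : Measurable H) {r : ℝ} (hr : 1 / 2 ≤ r)
    (z : Plane) : ∫⁻ x, H (z + r • x) ≤ 4 * ∫⁻ x, H x := by
  have hr0 : r ≠ 0 := by linarith
  have h1 : ∫⁻ x : Plane, H (z + r • x) = ENNReal.ofReal |(r ^ 2)⁻¹| * ∫⁻ x, H x := by
    have h2 := lintegral_map (μ := (volume : Measure Plane)) (f := fun x => H (z + x))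
      (g := fun x => r • x) (hH.comp (measurable_const_add z)) (measurable_const_smul r)
    rw [← h2, Measure.map_addHaar_smul _ hr0, lintegral_smul_measure, lintegral_add_left_eq_self]
    simp
  rw [h1]
  gcongr
  rw [← ENNReal.ofReal_ofNat]
  refine ENNReal.ofReal_le_ofReal ?_
  rw [abs_of_nonneg (by positivity), inv_le_comm₀ (by positivity) (by positivity)]
  nlinarith

/-- The point `y + t(x - y)` depends on `x` with factor `t` and on `y` with factor `1 - t`. One of
these is at least `1/2`, and the integration in that variable is the one rescaled, so the bound is
uniform in `t`. -/
theorem lintegral_segment_le {H : Plane → ℝ≥0∞} (hH : Measurable H) {t : ℝ} :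
    ∫⁻ y in D, ∫⁻ x in D, H (y + t • (x - y)) ≤ 4 * volume D * ∫⁻ x, H x := by
  rcases le_total (1 / 2) t with ht | ht
  · calc ∫⁻ y in D, ∫⁻ x in D, H (y + t • (x - y))
        ≤ ∫⁻ y in D, 4 * ∫⁻ x, H x := by
          refine lintegral_mono fun y => (setLIntegral_le_lintegral _ _).trans ?_
          have : ∀ x, y + t • (x - y) = (y - t • y) + t • x := fun x => by module
          simp only [this]
          exact lintegral_add_smul hH ht _
      _ = _ := by rw [setLIntegral_const]; ring
  · rw [lintegral_lintegral_swap (Measurable.aemeasurable (by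
      unfold Function.uncurry
      exact hH.comp (by fun_prop)))]
    calc ∫⁻ x in D, ∫⁻ y in D, H (y + t • (x - y))
        ≤ ∫⁻ x in D, 4 * ∫⁻ x, H x := by
          refine lintegral_mono fun x => (setLIntegral_le_lintegral _ _).trans ?_
          have : ∀ y, y + t • (x - y) = t • x + (1 - t) • y := fun y => by module
          simp only [this]
          exact lintegral_add_smul hH (by linarith) _
      _ = _ := by rw [setLIntegral_const]; ring

/-- A Bramble–Hilbert estimate with a constant independent of the shape of `D`. The average over
base points `y` of the Taylor remainder bound is controlled by `lintegral_segment_le`, so some `y`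
does no worse than the average. The exponent is 1 for the squared solution and 2 for the `L²`
estimates. -/
theorem exists_isPoly_integral_pow_le (hc : Convex ℝ D) (hK : IsCompact D) (h0 : volume D ≠ 0)
    (hf : ∀ x ∈ D, ContDiffAt ℝ (N + 1 : ℕ) f x) (hh : Metric.diam D ≤ h) (p : ℕ) :
    ∃ P, IsPoly N P ∧ ∫ x in D, |f x - P x| ^ p
      ≤ 4 * (h ^ (N + 1)) ^ p * ∫ x in D, ‖iteratedFDeriv ℝ (N + 1) f x‖ ^ p := by
  have hD : MeasurableSet D := hK.measurableSet
  have hnorm : ∀ x ∈ D, ∀ y ∈ D, ‖x - y‖ ≤ h := fun x hx y hy => by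
    rw [← dist_eq_norm]
    exact (Metric.dist_le_diam_of_mem hK.isBounded hx hy).trans hh
  have hh0 : 0 ≤ h := Metric.diam_nonneg.trans hh
  have hcont := continuousOn_norm_iteratedFDeriv_pow le_rfl p hf
  set H : Plane → ℝ≥0∞ := D.indicator
    (fun z => ENNReal.ofReal (‖iteratedFDeriv ℝ (N + 1) f z‖ ^ p)) with hH
  have hHm : Measurable H := by
    classical
    rw [hH, ← piecewise_eq_indicator]
    exact (ENNReal.continuous_ofReal.comp_continuousOn hcont).measurable_piecewise
      continuousOn_const hD
  let Ψ : Plane → ℝ≥0∞ := fun y => ∫⁻ x in D, ∫⁻ t in Icc (0 : ℝ) 1, H (y + t • (x - y))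
  have hm : Measurable fun q : (Plane × Plane) × ℝ => H (q.1.1 + q.2 • (q.1.2 - q.1.1)) :=
    hHm.comp (by fun_prop)
  have hm2 : Measurable fun q : Plane × Plane =>
      ∫⁻ t in Icc (0 : ℝ) 1, H (q.1 + t • (q.2 - q.1)) := hm.lintegral_prod_right'
  have hΨm : Measurable Ψ := hm2.lintegral_prod_right'
  -- Taylor expansion is taken about a point where `Ψ` is at most its mean. The factor `volume D` in
  -- `hΨ` cancels against the average.
  obtain ⟨y, hy, hyΨ⟩ := exists_le_setLAverage h0 hK.measure_lt_top.ne hΨm.aemeasurable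
  have hΨ : ∫⁻ y in D, Ψ y ≤ 4 * volume D * ∫⁻ x, H x := by
    have e1 : ∀ y, Ψ y = ∫⁻ t in Icc (0 : ℝ) 1, ∫⁻ x in D, H (y + t • (x - y)) := fun y =>
      lintegral_lintegral_swap (Measurable.aemeasurable (by
        unfold Function.uncurry
        exact hHm.comp (by fun_prop)))
    simp only [e1]
    rw [lintegral_lintegral_swap (Measurable.aemeasurable (by
      unfold Function.uncurry
      have : Measurable fun q : (Plane × ℝ) × Plane => H (q.1.1 + q.1.2 • (q.2 - q.1.1)) :=
        hHm.comp (by fun_prop)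
      exact this.lintegral_prod_right'))]
    refine (lintegral_mono fun t => lintegral_segment_le hHm).trans ?_
    simp
  have hΨy : Ψ y ≤ 4 * ∫⁻ x, H x := by
    refine hyΨ.trans ?_
    rw [setLAverage_eq]
    refine ENNReal.div_le_of_le_mul (hΨ.trans (le_of_eq ?_))
    ring
  refine ⟨taylorPoly N f y, isPoly_taylorPoly N f y, ?_⟩
  have hI : ENNReal.ofReal (∫ x in D, ‖iteratedFDeriv ℝ (N + 1) f x‖ ^ p) = ∫⁻ x, H x := by
    rw [hH, lintegral_indicator hD, ofReal_integral_eq_lintegral_ofReal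
      (hcont.integrableOn_compact hK) (ae_of_all _ fun t => by positivity)]
  have hfc : ContinuousOn (fun x => |f x - taylorPoly N f y x| ^ p) D :=
    (ContinuousOn.sub (fun x hx => (hf x hx).continuousAt.continuousWithinAt)
      (isPoly_taylorPoly N f y).continuous.continuousOn).abs.pow p
  have hI0 : 0 ≤ ∫ x in D, ‖iteratedFDeriv ℝ (N + 1) f x‖ ^ p :=
    integral_nonneg fun x => by positivity
  rw [← ENNReal.ofReal_le_ofReal_iff (by positivity), ofReal_integral_eq_lintegral_ofReal
      (hfc.integrableOn_compact hK) (ae_of_all _ fun t => by positivity),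
    ENNReal.ofReal_mul (by positivity), hI, ENNReal.ofReal_mul (by norm_num)]
  calc ∫⁻ x in D, ENNReal.ofReal (|f x - taylorPoly N f y x| ^ p)
      ≤ ∫⁻ x in D, ENNReal.ofReal ((h ^ (N + 1)) ^ p) *
          ∫⁻ t in Icc (0 : ℝ) 1, H (y + t • (x - y)) :=
        setLIntegral_mono' hD fun x hx =>
          abs_sub_taylorPoly_pow_le hc hf hx hy (hnorm x hx y hy) p
    _ = ENNReal.ofReal ((h ^ (N + 1)) ^ p) * Ψ y :=
        lintegral_const_mul' _ _ ENNReal.ofReal_ne_top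
    _ ≤ ENNReal.ofReal ((h ^ (N + 1)) ^ p) * (4 * ∫⁻ x, H x) := by gcongr
    _ = _ := by
      rw [ENNReal.ofReal_ofNat]
      ring

end Remainder

/-! ### Triangles and affine-invariant stability of the `L²` projection -/

section Triangle

variable {v : Fin 3 → Plane}

theorem affineSpan_eq_top (hv : AffineIndependent ℝ v) : affineSpan ℝ (range v) = ⊤ := by
  rw [hv.affineSpan_eq_top_iff_card_eq_finrank_add_one]
  simp

/-- The affine basis given by the vertices of a triangle. -/
def triangleBasis (hv : AffineIndependent ℝ v) : AffineBasis (Fin 3) ℝ Plane :=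
  ⟨v, hv, affineSpan_eq_top hv⟩

@[simp]
theorem coe_triangleBasis (hv : AffineIndependent ℝ v) : ⇑(triangleBasis hv) = v := rfl

theorem interior_triangle_nonempty (hv : AffineIndependent ℝ v) :
    (interior (convexHull ℝ (range v))).Nonempty :=
  interior_convexHull_nonempty_iff_affineSpan_eq_top.2 (affineSpan_eq_top hv)

theorem isCompact_triangle : IsCompact (convexHull ℝ (range v)) :=
  (finite_range v).isCompact_convexHull ℝ

theorem volume_triangle_ne_zero (hv : AffineIndependent ℝ v) :
    volume (convexHull ℝ (range v)) ≠ 0 :=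
  (Measure.measure_pos_of_nonempty_interior _ (interior_triangle_nonempty hv)).ne'

/-- The affine map sending the vertices of the triangle `v` to the points `w`. -/
def triangleMap (hv : AffineIndependent ℝ v) (w : Fin 3 → Plane) : Plane →ᵃ[ℝ] Plane where
  toFun x := ∑ i, (triangleBasis hv).coord i x • w i
  linear := ∑ i, ((triangleBasis hv).coord i).linear.smulRight (w i)
  map_vadd' p x := by
    have h : ∀ i, (triangleBasis hv).coord i (x + p)
        = ((triangleBasis hv).coord i).linear x + (triangleBasis hv).coord i p :=
      fun i => ((triangleBasis hv).coord i).map_vadd p x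
    simp only [LinearMap.sum_apply, LinearMap.smulRight_apply, vadd_eq_add, h, add_smul,
      Finset.sum_add_distrib]

theorem triangleMap_apply_vertex (hv : AffineIndependent ℝ v) (w : Fin 3 → Plane) (i : Fin 3) :
    triangleMap hv w (v i) = w i := by
  have h : ∀ j, (triangleBasis hv).coord j (v i) = if j = i then 1 else 0 := fun j => by
    rw [← (triangleBasis hv).coord_apply j i]
    rfl
  change ∑ j, (triangleBasis hv).coord j (v i) • w j = w i
  simp [h]

theorem triangleMap_triangleMap (hv : AffineIndependent ℝ v) {w : Fin 3 → Plane}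
    (hw : AffineIndependent ℝ w) (x : Plane) : triangleMap hw v (triangleMap hv w x) = x := by
  have : (triangleMap hw v).comp (triangleMap hv w) = AffineMap.id ℝ Plane := by
    refine AffineMap.ext_on (affineSpan_eq_top hv) ?_
    rintro _ ⟨i, rfl⟩
    simp [triangleMap_apply_vertex]
  exact congrArg (fun f : Plane →ᵃ[ℝ] Plane => f x) this

theorem image_triangleMap (hv : AffineIndependent ℝ v) (w : Fin 3 → Plane) :
    triangleMap hv w '' convexHull ℝ (range v) = convexHull ℝ (range w) := by
  rw [AffineMap.image_convexHull, ← range_comp]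
  congr 2
  funext i
  exact triangleMap_apply_vertex hv w i

theorem isPoly_affineMap (F : Plane →ᵃ[ℝ] Plane) (i : Fin 2) : IsPoly 1 fun x => F x i := by
  have h : ∀ x : Plane, F x i = x 0 * F.linear (EuclideanSpace.single 0 1) i
      + x 1 * F.linear (EuclideanSpace.single 1 1) i + F 0 i := by
    intro x
    have hx : x = x 0 • (EuclideanSpace.single 0 (1 : ℝ) : Plane)
        + x 1 • (EuclideanSpace.single 1 (1 : ℝ) : Plane) := by
      ext i
      fin_cases i <;> simp
    rw [AffineMap.decomp F]
    conv_lhs => rw [hx]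
    simp
  rw [funext h]
  exact ((((IsPoly.coord 0).mul (IsPoly.const (N := 0) _)).add
    ((IsPoly.coord 1).mul (IsPoly.const (N := 0) _)))).add (IsPoly.const _)

/-- The constant is the absolute Jacobian determinant. Only its positivity is needed, because it
cancels from both sides of orthogonality relations. -/
theorem integral_triangleMap (hv : AffineIndependent ℝ v) {w : Fin 3 → Plane}
    (hw : AffineIndependent ℝ w) : ∃ c : ℝ, 0 < c ∧ ∀ f : Plane → ℝ,
      ∫ x in convexHull ℝ (range w), f x
        = c * ∫ x in convexHull ℝ (range v), f (triangleMap hv w x) := by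
  set F := triangleMap hv w with hF
  let F' : Plane →L[ℝ] Plane := LinearMap.toContinuousLinearMap F.linear
  have hder : ∀ x, HasFDerivAt F F' x := fun x => by
    rw [AffineMap.decomp F]
    exact F'.hasFDerivAt.add_const _
  have hinj : Function.Injective F := fun x y hxy => by
    rw [← triangleMap_triangleMap hv hw x, ← triangleMap_triangleMap hv hw y, ← hF, hxy]
  have hdet : F'.det ≠ 0 := by
    have hlin : Function.Injective F.linear := F.linear_injective_iff.2 hinj
    have : IsUnit (LinearMap.det F.linear) :=
      (LinearMap.isUnit_iff_isUnit_det _).1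
        ((LinearMap.isUnit_iff_ker_eq_bot _).2 (LinearMap.ker_eq_bot.2 hlin))
    exact this.ne_zero
  refine ⟨|F'.det|, abs_pos.2 hdet, fun f => ?_⟩
  rw [← image_triangleMap hv w, integral_image_eq_integral_abs_det_fderiv_smul volume
    isCompact_triangle.measurableSet (fun x _ => (hder x).hasFDerivWithinAt) hinj.injOn,
    integral_smul, smul_eq_mul]

end Triangle

/-! ### Uniform sup-norm bound for the `L²` projection. -/

theorem IsPoly.integrableOn {N : ℕ} {f : Plane → ℝ} (hf : IsPoly N f) {K : Set Plane}
    (hK : IsCompact K) : IntegrableOn f K :=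
  hf.continuous.continuousOn.integrableOn_compact hK

/-- The `L²` inner product of polynomials on a compact set. -/
def polyForm (N : ℕ) {K : Set Plane} (hK : IsCompact K) :
    LinearMap.BilinForm ℝ (polySpace N) :=
  LinearMap.mk₂ ℝ (fun p q => ∫ x in K, (p : Plane → ℝ) x * (q : Plane → ℝ) x)
    (fun p₁ p₂ q => by
      simp only [Submodule.coe_add, Pi.add_apply, add_mul]
      exact integral_add ((p₁.2.mul q.2).integrableOn hK) ((p₂.2.mul q.2).integrableOn hK))
    (fun c p q => by
      simp only [Submodule.coe_smul, Pi.smul_apply, smul_eq_mul, mul_assoc]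
      exact integral_const_mul _ _)
    (fun p q₁ q₂ => by
      simp only [Submodule.coe_add, Pi.add_apply, mul_add]
      exact integral_add ((p.2.mul q₁.2).integrableOn hK) ((p.2.mul q₂.2).integrableOn hK))
    (fun c p q => by
      simp only [Submodule.coe_smul, Pi.smul_apply, smul_eq_mul, mul_left_comm _ c]
      exact integral_const_mul _ _)

/-- A polynomial with zero `L²` norm vanishes on the nonempty interior, hence identically.
Nondegeneracy provides the dual basis used in `exists_bound_of_orthogonal`. -/
theorem polyForm_nondegenerate (N : ℕ) {K : Set Plane} (hK : IsCompact K)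
    (hne : (interior K).Nonempty) : (polyForm N hK).Nondegenerate := by
  have key : ∀ p : polySpace N, polyForm N hK p p = 0 → p = 0 := by
    intro p hp
    have hp' : ∫ x in K, (p : Plane → ℝ) x * (p : Plane → ℝ) x = 0 := hp
    rw [setIntegral_eq_zero_iff_of_nonneg_ae (ae_of_all _ fun x => mul_self_nonneg _)
      ((p.2.mul p.2).integrableOn hK)] at hp'
    have h1 := Measure.eqOn_open_of_ae_eq
      (ae_restrict_of_ae_restrict_of_subset interior_subset hp') isOpen_interior
      ((p.2.mul p.2).continuous.continuousOn) continuousOn_const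
    ext x
    exact congrFun (p.2.eq_zero_of_isOpen isOpen_interior hne
      fun y hy => mul_self_eq_zero.1 (h1 hy)) x
  exact ⟨fun p hp => key p (hp p), fun p hp => key p (hp p)⟩

/-- Projection onto `P^N` commutes with affine maps, so everything is pulled back to one fixed
triangle. There the projection is expanded in a dual basis, whose sup norms and the `L¹` norms of
the primal basis give a constant depending on `N` alone. -/
theorem exists_bound_of_orthogonal (N : ℕ) : ∃ C : ℝ, 0 ≤ C ∧ ∀ v : Fin 3 → Plane,
    AffineIndependent ℝ v → ∀ (r f : Plane → ℝ) (δ : ℝ), IsPoly N r →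
    (∀ x ∈ convexHull ℝ (range v), |f x| ≤ δ) →
    (∀ w, IsPoly N w → ∫ x in convexHull ℝ (range v), r x * w x
      = ∫ x in convexHull ℝ (range v), f x * w x) →
    ∀ x ∈ convexHull ℝ (range v), |r x| ≤ C * δ := by
  classical
  -- Only a reference triangle is being fixed; without one the claim would be vacuous.
  by_cases hex : ∃ v₀ : Fin 3 → Plane, AffineIndependent ℝ v₀
  swap
  · exact ⟨0, le_rfl, fun v hv => (hex ⟨v, hv⟩).elim⟩
  obtain ⟨v₀, hv₀⟩ := hex
  set K := convexHull ℝ (range v₀) with hKdef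
  have hK : IsCompact K := isCompact_triangle
  let B := polyForm N hK
  have hB : B.Nondegenerate := polyForm_nondegenerate N hK (interior_triangle_nonempty hv₀)
  let b := Module.finBasis ℝ (polySpace N)
  let d := B.dualBasis hB b
  have hbd : ∀ i, ∃ c : ℝ, ∀ x ∈ K, ‖(d i : Plane → ℝ) x‖ ≤ c := fun i =>
    hK.exists_bound_of_continuousOn (d i).2.continuous.continuousOn
  choose c hc using hbd
  refine ⟨∑ i, |c i| * ∫ x in K, |(b i : Plane → ℝ) x|,
    Finset.sum_nonneg fun i _ => mul_nonneg (abs_nonneg _)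
      (integral_nonneg fun x => abs_nonneg _), ?_⟩
  intro v hv r f δ hr hf horth x hx
  obtain ⟨a, ha, hint⟩ := integral_triangleMap hv₀ hv
  have hmaps : ∀ y ∈ K, triangleMap hv₀ v y ∈ convexHull ℝ (range v) := fun y hy => by
    rw [← image_triangleMap hv₀ v]
    exact mem_image_of_mem _ hy
  let R : polySpace N := ⟨fun y => r (triangleMap hv₀ v y), hr.comp_of_coord (isPoly_affineMap _)⟩
  have hBR : ∀ i, |B R (b i)| ≤ δ * ∫ y in K, |(b i : Plane → ℝ) y| := by
    intro i
    have h1 := horth (fun y => (b i : Plane → ℝ) (triangleMap hv v₀ y))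
      ((b i).2.comp_of_coord (isPoly_affineMap _))
    rw [hint, hint] at h1
    have h2 := mul_left_cancel₀ ha.ne' h1
    simp only [triangleMap_triangleMap hv₀ hv] at h2
    have h3 : B R (b i) = ∫ y in K, f (triangleMap hv₀ v y) * (b i : Plane → ℝ) y := h2
    rw [h3, ← integral_const_mul, ← Real.norm_eq_abs]
    refine norm_integral_le_of_norm_le
      (((b i).2.integrableOn hK).abs.const_mul δ) ?_
    refine (ae_restrict_mem hK.measurableSet).mono fun y hy => ?_
    rw [norm_mul, Real.norm_eq_abs, Real.norm_eq_abs]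
    exact mul_le_mul_of_nonneg_right (hf _ (hmaps y hy)) (abs_nonneg _)
  have hδ : 0 ≤ δ := (abs_nonneg _).trans (hf x hx)
  have hy : triangleMap hv v₀ x ∈ K := by
    rw [hKdef, ← image_triangleMap hv v₀]
    exact mem_image_of_mem _ hx
  -- The dual basis turns the coefficients of `R` into its `L²` products with `b i`, which `hBR`
  -- controls.
  have hrep : r x = ∑ i, B R (b i) * (d i : Plane → ℝ) (triangleMap hv v₀ x) := by
    have h1 := congrFun (congrArg Subtype.val (d.sum_repr R)) (triangleMap hv v₀ x)
    have h2 : (R : Plane → ℝ) (triangleMap hv v₀ x) = r x := by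
      simp only [R, triangleMap_triangleMap hv hv₀]
    rw [← h2]
    refine h1.symm.trans ?_
    simp only [Submodule.coe_sum, Submodule.coe_smul, Finset.sum_apply, Pi.smul_apply,
      smul_eq_mul, d, LinearMap.BilinForm.dualBasis_repr_apply]
  rw [hrep, Finset.sum_mul]
  refine (Finset.abs_sum_le_sum_abs _ _).trans (Finset.sum_le_sum fun i _ => ?_)
  rw [abs_mul]
  have h4 : |(d i : Plane → ℝ) (triangleMap hv v₀ x)| ≤ |c i| := (hc i _ hy).trans (le_abs_self _)
  have h5 := mul_le_mul (hBR i) h4 (abs_nonneg _) ((abs_nonneg _).trans (hBR i))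
  refine h5.trans (le_of_eq ?_)
  ring

/-! ### Cancellation of the edge terms -/

/-- Endpoints are the extreme points of a segment. In the parameter along `a b`, the values 0 and 1
are convex combinations of `s, t ∈ [0, 1]`, which forces `{s, t} = {0, 1}`. -/
theorem endpoints_of_segment_eq {E : Type*} [AddCommGroup E] [Module ℝ E] {a b c d : E}
    (hab : a ≠ b) (h : segment ℝ a b = segment ℝ c d) : c = a ∧ d = b ∨ c = b ∧ d = a := by
  have hc : c ∈ segment ℝ a b := h ▸ left_mem_segment ℝ c d
  have hd : d ∈ segment ℝ a b := h ▸ right_mem_segment ℝ c d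
  have ha : a ∈ segment ℝ c d := h ▸ left_mem_segment ℝ a b
  have hb : b ∈ segment ℝ c d := h ▸ right_mem_segment ℝ a b
  rw [segment_eq_image'] at hc hd ha hb
  obtain ⟨s, hs, rfl⟩ := hc
  obtain ⟨t, ht, rfl⟩ := hd
  obtain ⟨r, hr, har⟩ := ha
  obtain ⟨q, hq, hbq⟩ := hb
  have hba : b - a ≠ 0 := sub_ne_zero.2 hab.symm
  have e1 : s + r * (t - s) = 0 := by
    refine (smul_eq_zero.1 (?_ : (s + r * (t - s)) • (b - a) = 0)).resolve_right hba
    rw [← sub_eq_zero] at har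
    refine Eq.trans ?_ har
    module
  have e2 : s + q * (t - s) = 1 := by
    rw [← sub_eq_zero]
    refine (smul_eq_zero.1 (?_ : (s + q * (t - s) - 1) • (b - a) = 0)).resolve_right hba
    rw [← sub_eq_zero] at hbq
    refine Eq.trans ?_ hbq
    module
  obtain ⟨hs0, hs1⟩ := hs
  obtain ⟨ht0, ht1⟩ := ht
  obtain ⟨hr0, hr1⟩ := hr
  obtain ⟨hq0, hq1⟩ := hq
  have f1 : (1 - r) * s = 0 := by nlinarith [mul_nonneg (sub_nonneg.2 hr1) hs0, mul_nonneg hr0 ht0]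
  have f2 : r * t = 0 := by nlinarith [mul_nonneg (sub_nonneg.2 hr1) hs0, mul_nonneg hr0 ht0]
  have f3 : (1 - q) * (1 - s) = 0 := by
    nlinarith [mul_nonneg (sub_nonneg.2 hq1) (sub_nonneg.2 hs1), mul_nonneg hq0 (sub_nonneg.2 ht1)]
  have f4 : q * (1 - t) = 0 := by
    nlinarith [mul_nonneg (sub_nonneg.2 hq1) (sub_nonneg.2 hs1), mul_nonneg hq0 (sub_nonneg.2 ht1)]
  have hst : (s = 0 ∧ t = 1) ∨ (s = 1 ∧ t = 0) := by
    rcases mul_eq_zero.1 f1 with h1 | h1 <;> rcases mul_eq_zero.1 f2 with h2 | h2 <;>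
      rcases mul_eq_zero.1 f3 with h3 | h3 <;> rcases mul_eq_zero.1 f4 with h4 | h4 <;>
      first
        | (exfalso; linarith)
        | (left; constructor <;> linarith)
        | (right; constructor <;> linarith)
  rcases hst with ⟨rfl, rfl⟩ | ⟨rfl, rfl⟩
  · left; constructor <;> module
  · right; constructor <;> module

/-! ### Geometry of shared edges. -/

namespace Triangulation

variable {Ω : Set Plane} (𝒯 : Triangulation Ω)

/-- The affine function measuring the signed distance (up to scale) to the `i`-th edge. -/
def edgeForm (k : Fin 𝒯.K) (i : Fin 3) (x : Plane) : ℝ :=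
  inner ℝ (𝒯.edgePerp k i) (x - 𝒯.edgeStart k i)

variable {𝒯}

theorem vert_injective (k : Fin 𝒯.K) : Function.Injective (𝒯.vert k) :=
  (𝒯.nondegenerate k).injective

theorem edgeStart_ne_edgeEnd (k : Fin 𝒯.K) (i : Fin 3) : 𝒯.edgeStart k i ≠ 𝒯.edgeEnd k i :=
  (vert_injective k).ne (by revert i; decide)

theorem edgePerp_ne_zero (k : Fin 𝒯.K) (i : Fin 3) : 𝒯.edgePerp k i ≠ 0 := by
  intro h
  apply edgeStart_ne_edgeEnd k i
  have h0 := congrArg (fun z : Plane => z 0) h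
  have h1 := congrArg (fun z : Plane => z 1) h
  simp only [edgePerp, PiLp.zero_apply] at h0 h1
  ext j
  fin_cases j
  · simp at h1 ⊢; linarith
  · simp at h0 ⊢; linarith

theorem edgeForm_edgeStart (k : Fin 𝒯.K) (i : Fin 3) : 𝒯.edgeForm k i (𝒯.edgeStart k i) = 0 := by
  simp [edgeForm]

theorem edgeForm_edgeEnd (k : Fin 𝒯.K) (i : Fin 3) : 𝒯.edgeForm k i (𝒯.edgeEnd k i) = 0 := by
  simp only [edgeForm, edgePerp, PiLp.inner_apply, Fin.sum_univ_two]
  simp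
  ring

theorem edgeForm_combination (k : Fin 𝒯.K) (i : Fin 3) (c : Fin 3 → ℝ) (hc : ∑ j, c j = 1)
    (w : Fin 3 → Plane) : 𝒯.edgeForm k i (∑ j, c j • w j) = ∑ j, c j * 𝒯.edgeForm k i (w j) := by
  have h : ∑ j, c j • w j - 𝒯.edgeStart k i = ∑ j, c j • (w j - 𝒯.edgeStart k i) := by
    simp only [smul_sub, Finset.sum_sub_distrib, ← Finset.sum_smul, hc, one_smul]
  rw [edgeForm, h, inner_sum]
  simp only [inner_smul_right, edgeForm]

/-- A function vanishing on the edge opposite to `w j` is a multiple of the `j`-th barycentric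
coordinate. -/
theorem edgeForm_eq_coord_mul (k : Fin 𝒯.K) (i : Fin 3) {w : Fin 3 → Plane}
    (hw : AffineIndependent ℝ w) (j : Fin 3) (h1 : 𝒯.edgeForm k i (w (j + 1)) = 0)
    (h2 : 𝒯.edgeForm k i (w (j + 2)) = 0) (x : Plane) :
    𝒯.edgeForm k i x = (triangleBasis hw).coord j x * 𝒯.edgeForm k i (w j) := by
  conv_lhs => rw [← (triangleBasis hw).linear_combination_coord_eq_self x]
  rw [edgeForm_combination k i _ ((triangleBasis hw).sum_coord_apply_eq_one x)]
  fin_cases j <;> simp [Fin.sum_univ_three] at h1 h2 ⊢ <;> simp [h1, h2]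

theorem edgeForm_ne_zero (k : Fin 𝒯.K) (i : Fin 3) {w : Fin 3 → Plane}
    (hw : AffineIndependent ℝ w) (j : Fin 3) (h1 : 𝒯.edgeForm k i (w (j + 1)) = 0)
    (h2 : 𝒯.edgeForm k i (w (j + 2)) = 0) : 𝒯.edgeForm k i (w j) ≠ 0 := by
  intro h
  have := edgeForm_eq_coord_mul k i hw j h1 h2 (𝒯.edgeStart k i + 𝒯.edgePerp k i)
  rw [h, mul_zero, edgeForm, add_sub_cancel_left, inner_self_eq_zero] at this
  exact edgePerp_ne_zero k i this

/-- Two triangles with a common edge lie on opposite sides of it. Otherwise a point moved slightly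
from the midpoint of the edge towards `v j` would be interior to both. -/
theorem edgeForm_mul_neg (k : Fin 𝒯.K) (i : Fin 3) {v w : Fin 3 → Plane}
    (hv : AffineIndependent ℝ v) (hw : AffineIndependent ℝ w)
    (hdis : Disjoint (interior (convexHull ℝ (range v))) (interior (convexHull ℝ (range w))))
    {j m : Fin 3} (hvw : v (j + 1) = w (m + 1) ∧ v (j + 2) = w (m + 2) ∨
      v (j + 1) = w (m + 2) ∧ v (j + 2) = w (m + 1))
    (h1 : 𝒯.edgeForm k i (v (j + 1)) = 0) (h2 : 𝒯.edgeForm k i (v (j + 2)) = 0) :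
    𝒯.edgeForm k i (v j) * 𝒯.edgeForm k i (w m) < 0 := by
  have h3 : 𝒯.edgeForm k i (w (m + 1)) = 0 := by
    rcases hvw with ⟨e, e'⟩ | ⟨e, e'⟩
    · rw [← e, h1]
    · rw [← e', h2]
  have h4 : 𝒯.edgeForm k i (w (m + 2)) = 0 := by
    rcases hvw with ⟨e, e'⟩ | ⟨e, e'⟩
    · rw [← e', h2]
    · rw [← e, h1]
  by_contra hcon
  have hpos : 0 < 𝒯.edgeForm k i (v j) * 𝒯.edgeForm k i (w m) :=
    lt_of_le_of_ne (not_lt.1 hcon) (mul_ne_zero (edgeForm_ne_zero k i hv j h1 h2)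
      (edgeForm_ne_zero k i hw m h3 h4)).symm
  let mid : Plane := (1 / 2 : ℝ) • v (j + 1) + (1 / 2 : ℝ) • v (j + 2)
  let γ : ℝ → Plane := fun t => mid + t • (v j - mid)
  have hγ : ∀ t, 𝒯.edgeForm k i (γ t) = t * 𝒯.edgeForm k i (v j) := by
    intro t
    simp only [edgeForm] at h1 h2 ⊢
    have : γ t - 𝒯.edgeStart k i = t • (v j - 𝒯.edgeStart k i)
        + ((1 - t) / 2) • (v (j + 1) - 𝒯.edgeStart k i)
        + ((1 - t) / 2) • (v (j + 2) - 𝒯.edgeStart k i) := by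
      simp only [γ, mid]
      module
    rw [this, inner_add_right, inner_add_right, inner_smul_right, inner_smul_right,
      inner_smul_right, h1, h2]
    ring
  have hγc : Continuous γ := by fun_prop
  -- At the midpoint the barycentric coordinates of the two edge vertices are `1/2`, so they stay
  -- positive nearby. The third coordinate is governed by the sign of `edgeForm`.
  have hhalf : ∀ {z : Fin 3 → Plane} (hz : AffineIndependent ℝ z) (r : Fin 3),
      mid = (1 / 2 : ℝ) • z (r + 1) + (1 / 2 : ℝ) • z (r + 2) →
      ∀ s, s ≠ r → ∀ᶠ t in nhdsWithin (0 : ℝ) (Ioi 0), 0 < (triangleBasis hz).coord s (γ t) := by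
    intro z hz r hmid s hs
    have hcont : Continuous fun t => (triangleBasis hz).coord s (γ t) :=
      (AffineMap.continuous_of_finiteDimensional _).comp hγc
    have hz' : ∀ p, (triangleBasis hz).coord s (z p) = if s = p then 1 else 0 := fun p => by
      rw [← (triangleBasis hz).coord_apply s p]
      rfl
    have h0 : (triangleBasis hz).coord s (γ 0) = 1 / 2 := by
      have e : γ 0 = AffineMap.lineMap (z (r + 1)) (z (r + 2)) (1 / 2 : ℝ) := by
        simp only [γ, zero_smul, add_zero, hmid, AffineMap.lineMap_apply, vsub_eq_sub,
          vadd_eq_add]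
        module
      rw [e, AffineMap.apply_lineMap, hz', hz', AffineMap.lineMap_apply]
      revert hs
      revert s r
      intro r hmid s
      fin_cases r <;> fin_cases s <;> simp <;> norm_num
    exact (hcont.continuousAt.eventually (lt_mem_nhds (by beta_reduce; rw [h0]; norm_num))).filter_mono
      nhdsWithin_le_nhds
  have hmidw : mid = (1 / 2 : ℝ) • w (m + 1) + (1 / 2 : ℝ) • w (m + 2) := by
    rcases hvw with ⟨e, e'⟩ | ⟨e, e'⟩
    · simp only [mid, e, e']
    · simp only [mid, e, e', add_comm]
  have hint : ∀ᶠ t in nhdsWithin (0 : ℝ) (Ioi 0), ∀ s,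
      0 < (triangleBasis hv).coord s (γ t) ∧ 0 < (triangleBasis hw).coord s (γ t) := by
    rw [Filter.eventually_all]
    intro s
    refine Filter.Eventually.and ?_ ?_
    · rcases eq_or_ne s j with rfl | hs
      · filter_upwards [self_mem_nhdsWithin] with t ht
        have := edgeForm_eq_coord_mul k i hv s h1 h2 (γ t)
        rw [hγ] at this
        rw [← mul_right_cancel₀ (edgeForm_ne_zero k i hv s h1 h2) this]
        exact ht
      · exact hhalf hv j rfl s hs
    · rcases eq_or_ne s m with rfl | hs
      · filter_upwards [self_mem_nhdsWithin] with t ht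
        have := edgeForm_eq_coord_mul k i hw s h3 h4 (γ t)
        rw [hγ] at this
        have ht' : (0 : ℝ) < t := ht
        have h5 : 0 < (triangleBasis hw).coord s (γ t) *
            (𝒯.edgeForm k i (w s) * 𝒯.edgeForm k i (w s)) := by
          rw [← mul_assoc, ← this, mul_assoc]
          exact mul_pos ht' hpos
        exact pos_of_mul_pos_left h5 (mul_self_nonneg _)
      · exact hhalf hw m hmidw s hs
  obtain ⟨t, ht⟩ := hint.exists
  refine Set.disjoint_left.1 hdis (?_ : γ t ∈ _) ?_
  · have := (triangleBasis hv).interior_convexHull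
    rw [coe_triangleBasis] at this
    rw [this]
    exact fun s => (ht s).1
  · have := (triangleBasis hw).interior_convexHull
    rw [coe_triangleBasis] at this
    rw [this]
    exact fun s => (ht s).2

theorem normal_ne_zero (k : Fin 𝒯.K) (i : Fin 3) : 𝒯.normal k i ≠ 0 := by
  have h := edgeForm_ne_zero k i (𝒯.nondegenerate k) i (edgeForm_edgeStart k i)
    (edgeForm_edgeEnd k i)
  have h2 : ‖𝒯.edgeEnd k i - 𝒯.edgeStart k i‖ ≠ 0 :=
    norm_ne_zero_iff.2 (sub_ne_zero.2 (edgeStart_ne_edgeEnd k i).symm)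
  refine smul_ne_zero ?_ (smul_ne_zero (inv_ne_zero h2) (edgePerp_ne_zero k i))
  rw [neg_ne_zero]
  rcases lt_or_gt_of_ne h with h | h
  · rw [edgeForm] at h
    rw [sign_neg h]; norm_num
  · rw [edgeForm] at h
    rw [sign_pos h]; norm_num

theorem endpoints_of_edge_eq {k l : Fin 𝒯.K} {i j : Fin 3} (h : 𝒯.edge l j = 𝒯.edge k i) :
    𝒯.edgeStart k i = 𝒯.edgeStart l j ∧ 𝒯.edgeEnd k i = 𝒯.edgeEnd l j ∨
      𝒯.edgeStart k i = 𝒯.edgeEnd l j ∧ 𝒯.edgeEnd k i = 𝒯.edgeStart l j :=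
  endpoints_of_segment_eq (edgeStart_ne_edgeEnd l j) h

/-- The opposite vertices lie on different sides. If the two triangles list the endpoints in the
same order, the rotated edge vector agrees and the sign flips; in the reversed order the vector
flips and the sign agrees. -/
theorem normal_eq_neg {k l : Fin 𝒯.K} {i j : Fin 3} (hkl : l ≠ k)
    (h : 𝒯.edge l j = 𝒯.edge k i) : 𝒯.normal l j = -𝒯.normal k i := by
  have hends := endpoints_of_edge_eq h
  have hneg := edgeForm_mul_neg k i (𝒯.nondegenerate k) (𝒯.nondegenerate l)
    (𝒯.nonoverlapping k l hkl.symm) (j := i) (m := j) hends (edgeForm_edgeStart k i)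
    (edgeForm_edgeEnd k i)
  have hsign : (SignType.sign (𝒯.edgeForm k i (𝒯.vert l j)) : ℝ)
      = -(SignType.sign (𝒯.edgeForm k i (𝒯.vert k i)) : ℝ) := by
    rcases mul_neg_iff.1 hneg with ⟨h1, h2⟩ | ⟨h1, h2⟩
    · rw [sign_neg h2, sign_pos h1]; norm_num
    · rw [sign_pos h2, sign_neg h1]; norm_num
  rcases hends with ⟨e1, e2⟩ | ⟨e1, e2⟩
  · have hp : 𝒯.edgePerp l j = 𝒯.edgePerp k i := by simp only [edgePerp, e1, e2]
    have h3 : inner ℝ (𝒯.edgePerp l j) (𝒯.vert l j - 𝒯.edgeStart l j)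
        = 𝒯.edgeForm k i (𝒯.vert l j) := by rw [edgeForm, hp, e1]
    have h4 : inner ℝ (𝒯.edgePerp k i) (𝒯.vert k i - 𝒯.edgeStart k i)
        = 𝒯.edgeForm k i (𝒯.vert k i) := rfl
    rw [normal, normal, h3, h4, hsign, hp, e1, e2]
    module
  · have hp : 𝒯.edgePerp l j = -𝒯.edgePerp k i := by
      simp only [edgePerp, e1, e2]
      ext r
      fin_cases r <;> simp
    have h3 : inner ℝ (𝒯.edgePerp l j) (𝒯.vert l j - 𝒯.edgeStart l j)
        = -𝒯.edgeForm k i (𝒯.vert l j) := by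
      have h5 := edgeForm_edgeEnd k i
      rw [edgeForm] at h5
      have : 𝒯.vert l j - 𝒯.edgeStart l j
          = (𝒯.vert l j - 𝒯.edgeStart k i) - (𝒯.edgeEnd k i - 𝒯.edgeStart k i) := by
        rw [e2]; module
      rw [edgeForm, hp, inner_neg_left, this, inner_sub_right, h5, sub_zero]
    have h4 : inner ℝ (𝒯.edgePerp k i) (𝒯.vert k i - 𝒯.edgeStart k i)
        = 𝒯.edgeForm k i (𝒯.vert k i) := rfl
    have h6 : ‖𝒯.edgeEnd l j - 𝒯.edgeStart l j‖ = ‖𝒯.edgeEnd k i - 𝒯.edgeStart k i‖ := by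
      rw [e1, e2, norm_sub_rev]
    rw [normal, normal, h3, h4, Left.sign_neg, SignType.coe_neg, hsign, hp, h6]
    module

theorem edge_index_unique {l : Fin 𝒯.K} {j j' : Fin 3} (h : 𝒯.edge l j = 𝒯.edge l j') :
    j = j' := by
  have key : ∀ a b : Fin 3, (b + 1 = a + 1 ∧ b + 2 = a + 2 ∨ b + 1 = a + 2 ∧ b + 2 = a + 1) →
      a = b := by decide
  refine key j j' ?_
  rcases endpoints_of_edge_eq h with ⟨e1, e2⟩ | ⟨e1, e2⟩
  · exact Or.inl ⟨vert_injective l e1, vert_injective l e2⟩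
  · exact Or.inr ⟨vert_injective l e1, vert_injective l e2⟩

/-- Of three distinct elements sharing an edge, any two would have opposite normals there, forcing a
normal to vanish. -/
theorem neighbor_unique {k l l' : Fin 𝒯.K} {i j j' : Fin 3} (hl : l ≠ k) (hl' : l' ≠ k)
    (h : 𝒯.edge l j = 𝒯.edge k i) (h' : 𝒯.edge l' j' = 𝒯.edge k i) : l = l' ∧ j = j' := by
  have hll : l = l' := by
    by_contra hne
    have e1 := normal_eq_neg hl h
    have e2 := normal_eq_neg hl' h'
    have e3 := normal_eq_neg hne (h.trans h'.symm)
    rw [e1, e2, neg_neg] at e3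
    have e4 := eq_neg_iff_add_eq_zero.1 e3.symm
    rw [← two_smul ℝ] at e4
    exact normal_ne_zero k i ((smul_eq_zero.1 e4).resolve_left two_ne_zero)
  subst hll
  exact ⟨rfl, edge_index_unique (h.trans h'.symm)⟩

theorem lineMap_mem_edge (k : Fin 𝒯.K) (i : Fin 3) {s : ℝ} (hs : s ∈ Icc (0 : ℝ) 1) :
    AffineMap.lineMap (𝒯.edgeStart k i) (𝒯.edgeEnd k i) s ∈ 𝒯.edge k i := by
  rw [edge, segment_eq_image_lineMap]
  exact mem_image_of_mem _ hs

theorem edgeIntegral_congr (k : Fin 𝒯.K) (i : Fin 3) {f g : Plane → ℝ}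
    (h : ∀ x ∈ 𝒯.edge k i, f x = g x) : 𝒯.edgeIntegral k i f = 𝒯.edgeIntegral k i g := by
  unfold edgeIntegral
  congr 1
  refine intervalIntegral.integral_congr fun s hs => ?_
  rw [uIcc_of_le zero_le_one] at hs
  exact h _ (lineMap_mem_edge k i hs)

theorem edgeIntegral_eq_of_edge_eq {k l : Fin 𝒯.K} {i j : Fin 3} (h : 𝒯.edge l j = 𝒯.edge k i)
    (f : Plane → ℝ) : 𝒯.edgeIntegral l j f = 𝒯.edgeIntegral k i f := by
  unfold edgeIntegral
  rcases endpoints_of_edge_eq h with ⟨e1, e2⟩ | ⟨e1, e2⟩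
  · rw [e1, e2]
  · rw [e1, e2, norm_sub_rev]
    congr 1
    have := intervalIntegral.integral_comp_sub_left (a := 0) (b := 1) (fun s =>
      f (AffineMap.lineMap (𝒯.edgeStart l j) (𝒯.edgeEnd l j) s)) (1 : ℝ)
    rw [sub_self, sub_zero] at this
    rw [← this]
    simp only [AffineMap.lineMap_apply_one_sub]

theorem edgeIntegral_neg (k : Fin 𝒯.K) (i : Fin 3) (f : Plane → ℝ) :
    𝒯.edgeIntegral k i (fun x => -f x) = -𝒯.edgeIntegral k i f := by
  simp [edgeIntegral]

/-- Matching each edge of an element with its copy in the neighbour is an involution on pairs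
(element, edge). The product `u⁺ u` is symmetric and the normals are opposite, so matched terms
cancel. Unmatched edges are fixed points, where the boundary condition makes the integrand zero. -/
theorem sum_edgeIntegral_flux_eq_zero (b : Plane → Plane) (u : Fin 𝒯.K → Plane → ℝ)
    (uext : Fin 𝒯.K → Fin 3 → Plane → ℝ)
    (hint : ∀ k i l, 𝒯.IsNeighbor k i l → ∀ x ∈ 𝒯.edge k i, uext k i x = u l x)
    (hbd : ∀ k i, (∀ l, ¬ 𝒯.IsNeighbor k i l) → ∀ x ∈ 𝒯.edge k i,
      u k x = 0 ∨ uext k i x = 0 ∨ inner ℝ (b x) (𝒯.normal k i) = 0) :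
    ∑ k, ∑ i, 𝒯.edgeIntegral k i
      (fun x => uext k i x * inner ℝ (b x) (𝒯.normal k i) * u k x) = 0 := by
  classical
  rw [← Fintype.sum_prod_type']
  let P : Fin 𝒯.K × Fin 3 → Fin 𝒯.K × Fin 3 → Prop := fun a c =>
    c.1 ≠ a.1 ∧ 𝒯.edge c.1 c.2 = 𝒯.edge a.1 a.2
  have hPsymm : ∀ a c, P a c → P c a := fun a c h => ⟨h.1.symm, h.2.symm⟩
  have hPuniq : ∀ a c c', P a c → P a c' → c = c' := fun a c c' h h' => by
    have := neighbor_unique h.1 h'.1 h.2 h'.2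
    exact Prod.ext this.1 this.2
  let σ : Fin 𝒯.K × Fin 3 → Fin 𝒯.K × Fin 3 := fun a => if h : ∃ c, P a c then h.choose else a
  have hσ : ∀ a c, P a c → σ a = c := fun a c h => by
    have hex : ∃ c, P a c := ⟨c, h⟩
    simp only [σ, dif_pos hex]
    exact hPuniq a _ _ hex.choose_spec h
  have hσ' : ∀ a, (¬ ∃ c, P a c) → σ a = a := fun a h => by simp only [σ, dif_neg h]
  have hval : ∀ a, (¬ ∃ c, P a c) → 𝒯.edgeIntegral a.1 a.2
      (fun x => uext a.1 a.2 x * inner ℝ (b x) (𝒯.normal a.1 a.2) * u a.1 x) = 0 := by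
    intro a h
    rw [edgeIntegral_congr (g := fun _ => 0)]
    · simp [edgeIntegral]
    · intro x hx
      have hno : ∀ l, ¬ 𝒯.IsNeighbor a.1 a.2 l := by
        rintro l ⟨hl, j, hj⟩
        exact h ⟨(l, j), hl, hj⟩
      rcases hbd a.1 a.2 hno x hx with h0 | h0 | h0 <;> simp [h0]
  refine Finset.sum_involution (fun a _ => σ a) (fun a _ => ?_) (fun a _ ha => ?_)
    (fun a _ => Finset.mem_univ _) (fun a _ => ?_)
  · by_cases h : ∃ c, P a c
    · obtain ⟨c, hc⟩ := h
      rw [hσ a c hc, edgeIntegral_eq_of_edge_eq hc.2, ← eq_neg_iff_add_eq_zero,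
        ← edgeIntegral_neg]
      refine edgeIntegral_congr _ _ fun x hx => ?_
      rw [hint a.1 a.2 c.1 ⟨hc.1, c.2, hc.2⟩ x hx,
        hint c.1 c.2 a.1 ⟨hc.1.symm, a.2, hc.2.symm⟩ x (hc.2 ▸ hx), normal_eq_neg hc.1 hc.2,
        inner_neg_right]
      ring
    · rw [hσ' a h, hval a h, add_zero]
  · by_cases h : ∃ c, P a c
    · obtain ⟨c, hc⟩ := h
      rw [hσ a c hc]
      rintro rfl
      exact hc.1 rfl
    · exact (ha (hval a h)).elim
  · by_cases h : ∃ c, P a c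
    · obtain ⟨c, hc⟩ := h
      rw [hσ a c hc, hσ c a (hPsymm _ _ hc)]
    · rw [hσ' a h, hσ' a h]

end Triangulation

/-! ### Time dependence of polynomials and of the energy -/

section Time

variable {N : ℕ} {T : ℝ} {q J : ℝ → Plane → ℝ} {D : Set Plane}

/-- Interpolation separates the variables: finitely many time-dependent point values multiply fixed
polynomials, so continuity in time at each point gives joint continuity. -/
theorem continuousOn_uncurry_of_isPoly (hq : ∀ t ∈ Icc 0 T, IsPoly N (q t))
    (hc : ∀ x, ContinuousOn (fun t => q t x) (Icc 0 T)) :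
    ContinuousOn (fun z : ℝ × Plane => q z.1 z.2) (Icc 0 T ×ˢ univ) := by
  obtain ⟨S, L, hL, hrep⟩ := exists_interpolation N
  have h : ContinuousOn (fun z : ℝ × Plane => ∑ p ∈ S, q z.1 p * L p z.2) (Icc 0 T ×ˢ univ) :=
    continuousOn_finsetSum _ fun p _ => ((hc p).comp continuousOn_fst fun z hz => hz.1).mul
      ((hL p).continuous.comp continuous_snd).continuousOn
  exact h.congr fun z hz => hrep _ (hq _ hz.1) _

/-- This makes the time derivatives of `q` and `J` admissible test functions. -/
theorem isPoly_deriv (hq : ∀ t ∈ Icc 0 T, IsPoly N (q t))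
    (hd : ∀ x, ∀ t ∈ Ioo 0 T, DifferentiableAt ℝ (fun s => q s x) t) {t : ℝ} (ht : t ∈ Ioo 0 T) :
    IsPoly N fun x => deriv (fun s => q s x) t := by
  obtain ⟨S, L, hL, hrep⟩ := exists_interpolation N
  have h : ∀ x, deriv (fun s => q s x) t = ∑ p ∈ S, deriv (fun s => q s p) t * L p x := by
    intro x
    have h1 : HasDerivAt (fun s => ∑ p ∈ S, q s p * L p x)
        (∑ p ∈ S, deriv (fun s => q s p) t * L p x) t :=
      HasDerivAt.fun_sum fun p _ => (hd p t ht).hasDerivAt.mul_const _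
    have h2 : (fun s => q s x) =ᶠ[nhds t] fun s => ∑ p ∈ S, q s p * L p x :=
      Filter.eventuallyEq_of_mem (Icc_mem_nhds ht.1 ht.2) fun s hs => hrep _ (hq s hs) x
    exact (h1.congr_of_eventuallyEq h2).deriv
  rw [funext h]
  exact IsPoly.sum fun p _ => (hL p).const_mul _

theorem exists_lipschitz_bound (hD : IsCompact D) (hq : ∀ t ∈ Icc 0 T, IsPoly N (q t))
    (hd : ∀ x, ∀ t ∈ Ioo 0 T, DifferentiableAt ℝ (fun s => q s x) t) {t : ℝ} (ht : t ∈ Ioo 0 T) :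
    ∃ C : ℝ, ∀ᶠ s in nhds t, ∀ x ∈ D, |q s x - q t x| ≤ C * |s - t| := by
  obtain ⟨S, L, hL, hrep⟩ := exists_interpolation N
  have h1 : ∀ p, ∃ c : ℝ, ∀ᶠ s in nhds t, |q s p - q t p| ≤ c * |s - t| := fun p =>
    (hd p t ht).hasDerivAt.isBigO_sub.bound
  choose c hc using h1
  have h2 : ∀ p, ∃ b : ℝ, ∀ x ∈ D, ‖L p x‖ ≤ b := fun p =>
    hD.exists_bound_of_continuousOn (hL p).continuous.continuousOn
  choose b hb using h2
  refine ⟨∑ p ∈ S, c p * b p, ?_⟩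
  have h3 : ∀ᶠ s in nhds t, ∀ p ∈ S, |q s p - q t p| ≤ c p * |s - t| :=
    (Finset.eventually_all S).2 fun p _ => hc p
  filter_upwards [h3, Icc_mem_nhds ht.1 ht.2] with s hs hsT x hx
  rw [hrep _ (hq s hsT) x, hrep _ (hq t (Ioo_subset_Icc_self ht)) x, ← Finset.sum_sub_distrib,
    Finset.sum_mul]
  refine (Finset.abs_sum_le_sum_abs _ _).trans (Finset.sum_le_sum fun p hp => ?_)
  rw [← sub_mul, abs_mul]
  calc |q s p - q t p| * |L p x| ≤ (c p * |s - t|) * b p :=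
        mul_le_mul (hs p hp) (hb p x hx) (abs_nonneg _) ((abs_nonneg _).trans (hs p hp))
    _ = c p * b p * |s - t| := by ring

/-- This bound depends on the solution. It serves only to pass limits under the integral and never
enters the final constant. -/
theorem exists_pos_lower_bound (hT : 0 ≤ T) (hD : IsCompact D)
    (hJ : ∀ t ∈ Icc 0 T, IsPoly N (J t)) (hc : ∀ x, ContinuousOn (fun t => J t x) (Icc 0 T))
    (hpos : ∀ t ∈ Icc 0 T, ∀ x ∈ D, 0 < J t x) :
    ∃ c : ℝ, 0 < c ∧ ∀ t ∈ Icc 0 T, ∀ x ∈ D, c ≤ J t x := by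
  rcases D.eq_empty_or_nonempty with rfl | hne
  · exact ⟨1, one_pos, by simp⟩
  obtain ⟨z, hz, hmin⟩ := (isCompact_Icc.prod hD).exists_isMinOn
    ((nonempty_Icc.2 hT).prod hne)
    ((continuousOn_uncurry_of_isPoly hJ hc).mono (prod_mono_right (subset_univ D)))
  exact ⟨J z.1 z.2, hpos _ hz.1 _ hz.2, fun t ht x hx => hmin (mk_mem_prod ht hx)⟩

theorem exists_upper_bound (hD : IsCompact D)
    (hq : ∀ t ∈ Icc 0 T, IsPoly N (q t)) (hc : ∀ x, ContinuousOn (fun t => q t x) (Icc 0 T)) :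
    ∃ Q : ℝ, ∀ t ∈ Icc 0 T, ∀ x ∈ D, |q t x| ≤ Q := by
  obtain ⟨Q, hQ⟩ := (isCompact_Icc.prod hD).exists_bound_of_continuousOn
    ((continuousOn_uncurry_of_isPoly hq hc).mono (prod_mono_right (subset_univ D)))
  exact ⟨Q, fun t ht x hx => hQ (t, x) (mk_mem_prod ht hx)⟩

theorem continuousOn_energyDensity {t : ℝ} (hq : IsPoly N (q t)) (hJ : IsPoly N (J t))
    (hpos : ∀ x ∈ D, 0 < J t x) : ContinuousOn (fun x => q t x / J t x * q t x) D :=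
  (hq.continuous.continuousOn.div hJ.continuous.continuousOn fun x hx => (hpos x hx).ne').mul
    hq.continuous.continuousOn

theorem continuousOn_integral_energyDensity (hT : 0 ≤ T) (hD : IsCompact D)
    (hq : ∀ t ∈ Icc 0 T, IsPoly N (q t)) (hJ : ∀ t ∈ Icc 0 T, IsPoly N (J t))
    (hpos : ∀ t ∈ Icc 0 T, ∀ x ∈ D, 0 < J t x)
    (hqc : ∀ x, ContinuousOn (fun t => q t x) (Icc 0 T))
    (hJc : ∀ x, ContinuousOn (fun t => J t x) (Icc 0 T)) :
    ContinuousOn (fun t => ∫ x in D, q t x / J t x * q t x) (Icc 0 T) := by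
  obtain ⟨c, hc, hcJ⟩ := exists_pos_lower_bound hT hD hJ hJc hpos
  obtain ⟨Q, hQ⟩ := exists_upper_bound hD hq hqc
  have hfin : IsFiniteMeasure (volume.restrict D) := ⟨by simpa using hD.measure_lt_top⟩
  refine continuousOn_of_dominated (bound := fun _ => Q / c * Q) (fun t ht => ?_)
    (fun t ht => ?_) (integrable_const _) ?_
  · exact (continuousOn_energyDensity (hq t ht) (hJ t ht) (hpos t ht)).aestronglyMeasurable
      hD.measurableSet
  · refine (ae_restrict_mem hD.measurableSet).mono fun x hx => ?_
    have h1 := hQ t ht x hx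
    have h2 := hcJ t ht x hx
    have h0 : 0 ≤ Q := (abs_nonneg _).trans h1
    rw [norm_mul, norm_div, Real.norm_eq_abs, Real.norm_eq_abs, abs_of_pos (hpos t ht x hx)]
    gcongr
  · refine (ae_restrict_mem hD.measurableSet).mono fun x hx => ?_
    exact ((hqc x).div (hJc x) fun t ht => (hpos t ht x hx).ne').mul (hqc x)

theorem hasDerivAt_integral_energyDensity (hD : IsCompact D)
    (hq : ∀ t ∈ Icc 0 T, IsPoly N (q t)) (hJ : ∀ t ∈ Icc 0 T, IsPoly N (J t))
    (hpos : ∀ t ∈ Icc 0 T, ∀ x ∈ D, 0 < J t x)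
    (hqc : ∀ x, ContinuousOn (fun t => q t x) (Icc 0 T))
    (hJc : ∀ x, ContinuousOn (fun t => J t x) (Icc 0 T))
    (hqd : ∀ x, ∀ t ∈ Ioo 0 T, DifferentiableAt ℝ (fun s => q s x) t)
    (hJd : ∀ x, ∀ t ∈ Ioo 0 T, DifferentiableAt ℝ (fun s => J s x) t)
    {t : ℝ} (ht : t ∈ Ioo 0 T) :
    HasDerivAt (fun t => ∫ x in D, q t x / J t x * q t x)
      (∫ x in D, (2 * (q t x / J t x * deriv (fun s => q s x) t)
        - (q t x / J t x) ^ 2 * deriv (fun s => J s x) t)) t := by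
  have hT : 0 ≤ T := (ht.1.trans ht.2).le
  have htI := Ioo_subset_Icc_self ht
  obtain ⟨c, hc, hcJ⟩ := exists_pos_lower_bound hT hD hJ hJc hpos
  obtain ⟨Q, hQ⟩ := exists_upper_bound hD hq hqc
  obtain ⟨A, hA⟩ := exists_lipschitz_bound hD hq hqd ht
  obtain ⟨B, hB⟩ := exists_lipschitz_bound hD hJ hJd ht
  have hfin : IsFiniteMeasure (volume.restrict D) := ⟨by simpa using hD.measure_lt_top⟩
  set d : Plane → ℝ := fun x => 2 * (q t x / J t x * deriv (fun s => q s x) t)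
        - (q t x / J t x) ^ 2 * deriv (fun s => J s x) t with hd
  have hdc : ContinuousOn d D := by
    have h1 : ContinuousOn (fun x => q t x / J t x) D :=
      (hq t htI).continuous.continuousOn.div (hJ t htI).continuous.continuousOn
        fun x hx => (hpos t htI x hx).ne'
    exact ((h1.mul (isPoly_deriv hq hqd ht).continuous.continuousOn).const_smul (2 : ℝ)).sub
      ((h1.pow 2).mul (isPoly_deriv hJ hJd ht).continuous.continuousOn)
  have hdm : AEStronglyMeasurable d (volume.restrict D) :=
    hdc.aestronglyMeasurable hD.measurableSet
  have hs := hA.and (hB.and (Filter.eventually_of_mem (Icc_mem_nhds ht.1 ht.2) fun s hs => hs))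
  have hL : Continuous fun r : ℝ => ContinuousLinearMap.toSpanSingleton ℝ r :=
    (ContinuousLinearMap.toSpanSingletonCLE (𝕜 := ℝ) (E := ℝ)).continuous
  -- This version compares only with the base time `t`, so differentiability at `t` suffices and no
  -- continuity of the time derivative is needed.
  have hmain := hasFDerivAt_integral_of_dominated_loc_of_lip' (𝕜 := ℝ) (μ := volume.restrict D)
    (F := fun s x => q s x / J s x * q s x) (x₀ := t)
    (F' := fun x => ContinuousLinearMap.toSpanSingleton ℝ (d x))
    (bound := fun _ => 2 * Q * A / c + Q ^ 2 * B / (c * c)) hs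
    (fun s hs => (continuousOn_energyDensity (hq s hs.2.2) (hJ s hs.2.2)
      (hpos s hs.2.2)).aestronglyMeasurable hD.measurableSet)
    ((continuousOn_energyDensity (hq t htI) (hJ t htI) (hpos t htI)).integrableOn_compact hD)
    (hL.comp_aestronglyMeasurable hdm)
    ?_ (integrable_const _) ?_
  · obtain ⟨hint, hder⟩ := hmain
    refine hder.hasDerivAt.congr_deriv ?_
    rw [ContinuousLinearMap.integral_apply hint]
    simp
  · refine (ae_restrict_mem hD.measurableSet).mono fun x hx s hs => ?_
    have a1 := hs.1 x hx
    have a2 := hs.2.1 x hx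
    have a3 := hcJ s hs.2.2 x hx
    have a4 := hcJ t htI x hx
    have a5 := hQ s hs.2.2 x hx
    have a6 := hQ t htI x hx
    have h0 : 0 ≤ Q := (abs_nonneg _).trans a6
    have p1 := hpos s hs.2.2 x hx
    have p2 := hpos t htI x hx
    have e : q s x / J s x * q s x - q t x / J t x * q t x
        = (q s x + q t x) * (q s x - q t x) / J s x
          - q t x ^ 2 * (J s x - J t x) / (J s x * J t x) := by
      field_simp
      ring
    rw [Real.norm_eq_abs, Real.norm_eq_abs, e, add_mul (2 * Q * A / c)]
    refine (abs_sub _ _).trans (add_le_add ?_ ?_)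
    · rw [abs_div, abs_mul, abs_of_pos p1]
      calc |q s x + q t x| * |q s x - q t x| / J s x
          ≤ (2 * Q) * (A * |s - t|) / c := by
            have : |q s x + q t x| ≤ 2 * Q := (abs_add_le _ _).trans (by linarith)
            have := mul_le_mul this a1 (abs_nonneg _) (by positivity)
            have h' : 0 ≤ 2 * Q * (A * |s - t|) := le_trans (by positivity) this
            exact div_le_div₀ h' this hc a3
        _ = _ := by ring
    · rw [abs_div, abs_mul, abs_of_pos (mul_pos p1 p2), abs_pow]
      calc |q t x| ^ 2 * |J s x - J t x| / (J s x * J t x)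
          ≤ Q ^ 2 * (B * |s - t|) / (c * c) := by
            have : |q t x| ^ 2 ≤ Q ^ 2 := pow_le_pow_left₀ (abs_nonneg _) a6 2
            have := mul_le_mul this a2 (abs_nonneg _) (by positivity)
            have h' : 0 ≤ Q ^ 2 * (B * |s - t|) := le_trans (by positivity) this
            exact div_le_div₀ h' this (by positivity) (mul_le_mul a3 a4 hc.le p1.le)
        _ = _ := by ring
  · refine (ae_restrict_mem hD.measurableSet).mono fun x hx => ?_
    have p2 := hpos t htI x hx
    have h1 : HasDerivAt (fun s => q s x / J s x * q s x) (d x) t := by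
      refine (((hqd x t ht).hasDerivAt.div (hJd x t ht).hasDerivAt p2.ne').mul
        (hqd x t ht).hasDerivAt).congr_deriv ?_
      simp only [hd, Pi.div_apply]
      field_simp
      ring
    exact h1.hasFDerivAt

end Time

/-! ### Regularity of the mesh flux -/

theorem det_plane (A : Plane →L[ℝ] Plane) :
    A.det = A (EuclideanSpace.single 0 1) 0 * A (EuclideanSpace.single 1 1) 1
      - A (EuclideanSpace.single 1 1) 0 * A (EuclideanSpace.single 0 1) 1 := by
  rw [ContinuousLinearMap.det, ← LinearMap.det_toMatrix (EuclideanSpace.basisFun (Fin 2) ℝ).toBasis,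
    Matrix.det_fin_two]
  simp [LinearMap.toMatrix_apply]

theorem hasFDerivAt_slice {F : Type*} [NormedAddCommGroup F] [NormedSpace ℝ F]
    {H : ℝ → Plane → F} {p : ℝ × Plane}
    (h : DifferentiableAt ℝ (fun z : ℝ × Plane => H z.1 z.2) p) :
    HasFDerivAt (H p.1) ((fderiv ℝ (fun z : ℝ × Plane => H z.1 z.2) p).comp
      (ContinuousLinearMap.inr ℝ ℝ Plane)) p.2 :=
  HasFDerivAt.comp (g := fun z : ℝ × Plane => H z.1 z.2) (f := fun y => (p.1, y)) p.2
    h.hasFDerivAt (hasFDerivAt_prodMk_right p.1 p.2)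

theorem hasDerivAt_slice {F : Type*} [NormedAddCommGroup F] [NormedSpace ℝ F]
    {H : ℝ → Plane → F} {p : ℝ × Plane}
    (h : DifferentiableAt ℝ (fun z : ℝ × Plane => H z.1 z.2) p) :
    HasDerivAt (fun s => H s p.2) (fderiv ℝ (fun z : ℝ × Plane => H z.1 z.2) p (1, 0)) p.1 := by
  refine (HasFDerivAt.comp (g := fun z : ℝ × Plane => H z.1 z.2) (f := fun s => (s, p.2)) p.1
    h.hasFDerivAt (hasFDerivAt_prodMk_left p.1 p.2)).hasDerivAt.congr_deriv ?_
  simp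

section Flux

variable {X : ℝ → Plane → Plane} {n : ℕ} {p : ℝ × Plane}

/-- Near `p` the flux is an expression in the joint derivative of `X`, through determinant, inverse
and evaluation, so exactly one order of smoothness is lost. The divergence loses another, which
takes `N + 3` down to `N + 1`. -/
theorem contDiffAt_meshFlux (hX : ContDiffAt ℝ (n + 1 : ℕ) (fun z : ℝ × Plane => X z.1 z.2) p)
    (hdet : jacobian X p.1 p.2 ≠ 0) :
    ContDiffAt ℝ n (fun z : ℝ × Plane => meshFlux X z.1 z.2) p := by
  set Y : ℝ × Plane → Plane := fun z => X z.1 z.2 with hY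
  have hev : ∀ᶠ z in nhds p, DifferentiableAt ℝ Y z :=
    (hX.eventually (by simp)).mono fun z hz => hz.differentiableAt (by simp)
  let A : ℝ × Plane → Plane →L[ℝ] Plane := fun z =>
    (fderiv ℝ Y z).comp (ContinuousLinearMap.inr ℝ ℝ Plane)
  have hfd : ContDiffAt ℝ n (fderiv ℝ Y) p := hX.fderiv_right (by norm_cast)
  have hA : ContDiffAt ℝ n A p := hfd.clm_comp contDiffAt_const
  have hApp : ContDiffAt ℝ n (fun z => fderiv ℝ Y z (1, 0)) p := hfd.clm_apply contDiffAt_const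
  have hcoord : ∀ i j : Fin 2, ContDiffAt ℝ n
      (fun z => A z (EuclideanSpace.single i 1) j) p := fun i j =>
    (contDiffAt_euclidean.1 (hA.clm_apply contDiffAt_const)) j
  have hd : ContDiffAt ℝ n (fun z => (A z).det) p := by
    simp only [det_plane]
    exact ((hcoord 0 0).mul (hcoord 1 1)).sub ((hcoord 1 0).mul (hcoord 0 1))
  have hAp : fderiv ℝ (X p.1) p.2 = A p := (hasFDerivAt_slice hev.self_of_nhds).fderiv
  have hdet' : (A p).det ≠ 0 := by rwa [← hAp]
  have hinv : ContDiffAt ℝ n (fun z => (A z).inverse) p := by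
    have h1 : ContDiffAt ℝ n (ContinuousLinearMap.inverse : (Plane →L[ℝ] Plane) → _) (A p) :=
      contDiffAt_map_inverse ((A p).toContinuousLinearEquivOfDetNeZero hdet')
    exact h1.comp p hA
  have hmain : ContDiffAt ℝ n
      (fun z => (A z).det • -((A z).inverse (fderiv ℝ Y z (1, 0)))) p :=
    hd.smul (hinv.clm_apply hApp).neg
  refine hmain.congr_of_eventuallyEq (hev.mono fun z hz => ?_)
  simp only [meshFlux, jacobian, refVelocity]
  rw [(hasFDerivAt_slice hz).fderiv, (hasDerivAt_slice hz).deriv]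

theorem contDiffAt_divergence_meshFlux
    (hX : ContDiffAt ℝ (n + 2 : ℕ) (fun z : ℝ × Plane => X z.1 z.2) p)
    (hdet : jacobian X p.1 p.2 ≠ 0) :
    ContDiffAt ℝ n (fun z : ℝ × Plane => divergence (meshFlux X z.1) z.2) p := by
  have hF : ContDiffAt ℝ (n + 1 : ℕ) (fun z : ℝ × Plane => meshFlux X z.1 z.2) p :=
    contDiffAt_meshFlux hX hdet
  have hev : ∀ᶠ z in nhds p, DifferentiableAt ℝ (fun z : ℝ × Plane => meshFlux X z.1 z.2) z :=
    (hF.eventually (by simp)).mono fun z hz => hz.differentiableAt (by simp)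
  have hfd : ContDiffAt ℝ n (fderiv ℝ fun z : ℝ × Plane => meshFlux X z.1 z.2) p :=
    hF.fderiv_right (by norm_cast)
  have hmain : ContDiffAt ℝ n (fun z => ∑ i : Fin 2,
      (fderiv ℝ (fun z : ℝ × Plane => meshFlux X z.1 z.2) z (0, EuclideanSpace.single i 1)) i) p :=
    ContDiffAt.sum fun i _ => contDiffAt_euclidean.1 (hfd.clm_apply contDiffAt_const) i
  refine hmain.congr_of_eventuallyEq (hev.mono fun z hz => ?_)
  simp only [divergence]
  rw [(hasFDerivAt_slice hz).fderiv]
  simp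

end Flux

/-- Spatial derivatives of a slice are the joint derivatives restricted to spatial directions, an
operation of norm at most 1. Compactness of the space-time set then gives a bound uniform in time.
-/
theorem exists_bound_iteratedFDeriv_slice {n : ℕ} {g : ℝ → Plane → ℝ} {K : Set (ℝ × Plane)}
    (hK : IsCompact K) (hg : ∀ p ∈ K, ContDiffAt ℝ n (fun z : ℝ × Plane => g z.1 z.2) p) :
    ∃ G : ℝ, ∀ p ∈ K, ContDiffAt ℝ n (g p.1) p.2 ∧
      ∀ j ≤ n, ‖iteratedFDeriv ℝ j (g p.1) p.2‖ ≤ G := by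
  set H : ℝ × Plane → ℝ := fun z => g z.1 z.2 with hH
  have hb : ∀ j, ∃ C : ℝ, j ≤ n → ∀ p ∈ K, ‖iteratedFDeriv ℝ j H p‖ ≤ C := by
    intro j
    by_cases hj : j ≤ n
    · obtain ⟨C, hC⟩ := hK.exists_bound_of_continuousOn (f := iteratedFDeriv ℝ j H) fun p hp =>
        ((hg p hp).iteratedFDeriv_right (m := 0) (i := j)
          (by simpa using hj)).continuousAt.continuousWithinAt
      exact ⟨C, fun _ => hC⟩
    · exact ⟨0, fun h => (hj h).elim⟩
  choose C hC using hb
  refine ⟨∑ j ∈ Finset.range (n + 1), |C j|, fun p hp => ⟨?_, fun j hj => ?_⟩⟩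
  · exact ContDiffAt.comp (g := H) (f := fun y => (p.1, y)) p.2 (hg p hp)
      (contDiffAt_const.prodMk contDiffAt_id)
  · let V : Set (ℝ × Plane) := (fun z => (p.1, 0) + z) ⁻¹' {z | ContDiffAt ℝ n H z}
    have hopen : IsOpen {z | ContDiffAt ℝ n H z} := isOpen_iff_mem_nhds.2 fun z hz =>
      ContDiffAt.eventually hz (by simp)
    have hVo : IsOpen V := hopen.preimage (by fun_prop)
    let ι : Plane →L[ℝ] ℝ × Plane := ContinuousLinearMap.inr ℝ ℝ Plane
    have hιo : IsOpen (ι ⁻¹' V) := hVo.preimage ι.continuous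
    have hpι : (p.1, 0) + ι p.2 = p := by simp [ι]
    have hpV : ι p.2 ∈ V := by
      change ContDiffAt ℝ n H ((p.1, 0) + ι p.2)
      rw [hpι]
      exact hg p hp
    have hHV : ContDiffOn ℝ n (fun z => H ((p.1, 0) + z)) V := fun z hz =>
      (ContDiffAt.comp (𝕜 := ℝ) (n := n) (g := H) (f := fun z => (p.1, 0) + z) z hz
        (contDiffAt_const.add contDiffAt_id)).contDiffWithinAt
    have h1 := ι.iteratedFDerivWithin_comp_right hHV hVo.uniqueDiffOn hιo.uniqueDiffOn hpV
      (i := j) (by exact_mod_cast hj)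
    rw [iteratedFDerivWithin_of_isOpen j hVo hpV, iteratedFDerivWithin_of_isOpen j hιo hpV,
      iteratedFDeriv_comp_add_left, hpι] at h1
    have h2 : (fun z => H ((p.1, 0) + z)) ∘ ι = g p.1 := by
      funext y
      simp [ι, H]
    rw [h2] at h1
    rw [h1]
    refine (ContinuousMultilinearMap.norm_compContinuousLinearMap_le _ _).trans ?_
    have h3 : ∏ _i : Fin j, ‖ι‖ ≤ 1 :=
      Finset.prod_le_one (fun _ _ => norm_nonneg _)
        fun _ _ => ContinuousLinearMap.norm_inr_le_one ℝ ℝ Plane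
    refine (mul_le_of_le_one_right (norm_nonneg _) h3).trans ?_
    refine (hC j hj p hp).trans ((le_abs_self _).trans ?_)
    exact Finset.single_le_sum (f := fun j => |C j|) (fun i _ => abs_nonneg _)
      (Finset.mem_range.2 (Nat.lt_succ_iff.2 hj))

/-! ### Estimates on one element -/

/-- The integrand of the squared Sobolev norm of order `m`. -/
def sobolevDensity (m : ℕ) (a : Plane → ℝ) (x : Plane) : ℝ :=
  ∑ j ∈ Finset.range (m + 1), ‖iteratedFDeriv ℝ j a x‖ ^ 2

section Density

variable {m : ℕ} {a f : Plane → ℝ} {x : Plane}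

theorem sobolevDensity_nonneg : 0 ≤ sobolevDensity m a x :=
  Finset.sum_nonneg fun _ _ => sq_nonneg _

theorem norm_iteratedFDeriv_sq_le {j : ℕ} (hj : j ≤ m) :
    ‖iteratedFDeriv ℝ j a x‖ ^ 2 ≤ sobolevDensity m a x :=
  Finset.single_le_sum (f := fun j => ‖iteratedFDeriv ℝ j a x‖ ^ 2) (fun _ _ => sq_nonneg _)
    (Finset.mem_range.2 (Nat.lt_succ_iff.2 hj))

theorem norm_iteratedFDeriv_le_sqrt {j : ℕ} (hj : j ≤ m) :
    ‖iteratedFDeriv ℝ j a x‖ ≤ √(sobolevDensity m a x) :=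
  Real.le_sqrt_of_sq_le (norm_iteratedFDeriv_sq_le hj)

theorem sq_le_sobolevDensity : a x ^ 2 ≤ sobolevDensity m a x := by
  have := norm_iteratedFDeriv_sq_le (m := m) (a := a) (x := x) (Nat.zero_le m)
  simpa using this

theorem norm_iteratedFDeriv_mul_le_of_contDiffAt (hf : ContDiffAt ℝ m f x)
    (ha : ContDiffAt ℝ m a x) : ‖iteratedFDeriv ℝ m (fun y => f y * a y) x‖
      ≤ ∑ i ∈ Finset.range (m + 1), (m.choose i : ℝ) * ‖iteratedFDeriv ℝ i f x‖
        * ‖iteratedFDeriv ℝ (m - i) a x‖ := by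
  set W : Set Plane := {y | ContDiffAt ℝ m f y} ∩ {y | ContDiffAt ℝ m a y}
  have hW : IsOpen W := (isOpen_iff_mem_nhds.2 fun z hz => ContDiffAt.eventually hz (by simp)).inter
    (isOpen_iff_mem_nhds.2 fun z hz => ContDiffAt.eventually hz (by simp))
  have hx : x ∈ W := ⟨hf, ha⟩
  have h := norm_iteratedFDerivWithin_mul_le (s := W) (N := m) (n := m)
    (fun y hy => (show ContDiffAt ℝ m f y from hy.1).contDiffWithinAt)
    (fun y hy => (show ContDiffAt ℝ m a y from hy.2).contDiffWithinAt) hW.uniqueDiffOn hx le_rfl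
  simpa only [iteratedFDerivWithin_of_isOpen _ hW hx] using h

theorem sum_choose_mul (c : ℝ) : ∑ i ∈ Finset.range (m + 1), (m.choose i : ℝ) * c = 2 ^ m * c := by
  rw [← Finset.sum_mul]
  congr 1
  exact_mod_cast Nat.sum_range_choose m

theorem norm_iteratedFDeriv_sq_self_le (ha : ContDiffAt ℝ m a x) :
    ‖iteratedFDeriv ℝ m (fun y => a y * a y) x‖ ≤ 2 ^ m * sobolevDensity m a x := by
  refine (norm_iteratedFDeriv_mul_le_of_contDiffAt ha ha).trans ?_
  rw [← sum_choose_mul]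
  refine Finset.sum_le_sum fun i hi => ?_
  rw [mul_assoc]
  gcongr
  calc ‖iteratedFDeriv ℝ i a x‖ * ‖iteratedFDeriv ℝ (m - i) a x‖
      ≤ √(sobolevDensity m a x) * √(sobolevDensity m a x) :=
        mul_le_mul (norm_iteratedFDeriv_le_sqrt (Nat.lt_succ_iff.1 (Finset.mem_range.1 hi)))
          (norm_iteratedFDeriv_le_sqrt (Nat.sub_le _ _)) (norm_nonneg _) (Real.sqrt_nonneg _)
    _ = _ := Real.mul_self_sqrt sobolevDensity_nonneg

/-- Leibniz' rule: the binomial coefficients sum to `2^m`, and squaring gives `4^m`. -/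
theorem norm_iteratedFDeriv_mul_sq_le {G : ℝ} (hf : ContDiffAt ℝ m f x)
    (hG : ∀ j ≤ m, ‖iteratedFDeriv ℝ j f x‖ ≤ G) (ha : ContDiffAt ℝ m a x) :
    ‖iteratedFDeriv ℝ m (fun y => f y * a y) x‖ ^ 2 ≤ 4 ^ m * G ^ 2 * sobolevDensity m a x := by
  have hG0 : 0 ≤ G := (norm_nonneg _).trans (hG 0 (Nat.zero_le m))
  have h : ‖iteratedFDeriv ℝ m (fun y => f y * a y) x‖
      ≤ 2 ^ m * (G * √(sobolevDensity m a x)) := by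
    refine (norm_iteratedFDeriv_mul_le_of_contDiffAt hf ha).trans ?_
    rw [← sum_choose_mul]
    refine Finset.sum_le_sum fun i hi => ?_
    rw [mul_assoc]
    gcongr
    · exact hG i (Nat.lt_succ_iff.1 (Finset.mem_range.1 hi))
    · exact norm_iteratedFDeriv_le_sqrt (Nat.sub_le _ _)
  refine (pow_le_pow_left₀ (norm_nonneg _) h 2).trans (le_of_eq ?_)
  rw [mul_pow, mul_pow, Real.sq_sqrt sobolevDensity_nonneg, ← pow_mul, mul_comm m 2, pow_mul]
  norm_num
  ring

theorem continuousOn_sobolevDensity {D : Set Plane} (ha : ∀ x ∈ D, ContDiffAt ℝ m a x) :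
    ContinuousOn (sobolevDensity m a) D :=
  continuousOn_finsetSum _ fun _ hj =>
    continuousOn_norm_iteratedFDeriv_pow (Nat.lt_succ_iff.1 (Finset.mem_range.1 hj)) 2 ha

end Density

section Element

variable {N : ℕ} {D : Set Plane} {h : ℝ} {a f g w : Plane → ℝ}

theorem continuousOn_of_contDiffAt {n : ℕ} (ha : ∀ x ∈ D, ContDiffAt ℝ n a x) :
    ContinuousOn a D := fun x hx => (ha x hx).continuousAt.continuousWithinAt

theorem exists_isPoly_sub_integral_sq_le (hc : Convex ℝ D) (hK : IsCompact D) (h0 : volume D ≠ 0)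
    (ha : ∀ x ∈ D, ContDiffAt ℝ (N + 1 : ℕ) a x) (hh : Metric.diam D ≤ h) :
    ∃ P, IsPoly N P ∧ ∫ x in D, (a x - P x) ^ 2
      ≤ 4 * h ^ (2 * N + 2) * ∫ x in D, sobolevDensity (N + 1) a x := by
  obtain ⟨P, hP, hle⟩ := exists_isPoly_integral_pow_le hc hK h0 ha hh 2
  have hh0 : 0 ≤ h := Metric.diam_nonneg.trans hh
  refine ⟨P, hP, ?_⟩
  simp only [sq_abs] at hle
  refine hle.trans ?_
  rw [← pow_mul, show (N + 1) * 2 = 2 * N + 2 by ring]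
  gcongr ?_ * ?_
  exact setIntegral_mono_on ((continuousOn_norm_iteratedFDeriv_pow le_rfl 2 ha).integrableOn_compact
    hK) ((continuousOn_sobolevDensity ha).integrableOn_compact hK) hK.measurableSet
    fun x _ => norm_iteratedFDeriv_sq_le le_rfl

theorem exists_isPoly_mul_sub_integral_sq_le (hc : Convex ℝ D) (hK : IsCompact D)
    (h0 : volume D ≠ 0) (hf : ∀ x ∈ D, ContDiffAt ℝ (N + 1 : ℕ) f x) {G : ℝ}
    (hG : ∀ x ∈ D, ∀ j ≤ N + 1, ‖iteratedFDeriv ℝ j f x‖ ≤ G)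
    (ha : ∀ x ∈ D, ContDiffAt ℝ (N + 1 : ℕ) a x) (hh : Metric.diam D ≤ h) :
    ∃ P, IsPoly N P ∧ ∫ x in D, (f x * a x - P x) ^ 2
      ≤ 4 ^ (N + 2) * G ^ 2 * h ^ (2 * N + 2) * ∫ x in D, sobolevDensity (N + 1) a x := by
  have hfa : ∀ x ∈ D, ContDiffAt ℝ (N + 1 : ℕ) (fun y => f y * a y) x :=
    fun x hx => (hf x hx).mul (ha x hx)
  obtain ⟨P, hP, hle⟩ := exists_isPoly_integral_pow_le hc hK h0 hfa hh 2
  have hh0 : 0 ≤ h := Metric.diam_nonneg.trans hh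
  refine ⟨P, hP, ?_⟩
  simp only [sq_abs] at hle
  have h1 : ∫ x in D, ‖iteratedFDeriv ℝ (N + 1) (fun y => f y * a y) x‖ ^ 2
      ≤ ∫ x in D, 4 ^ (N + 1) * G ^ 2 * sobolevDensity (N + 1) a x :=
    setIntegral_mono_on
      ((continuousOn_norm_iteratedFDeriv_pow le_rfl 2 hfa).integrableOn_compact hK)
      (((continuousOn_sobolevDensity ha).integrableOn_compact hK).const_mul _) hK.measurableSet
      fun x hx => norm_iteratedFDeriv_mul_sq_le (hf x hx) (hG x hx) (ha x hx)
  rw [integral_const_mul] at h1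
  refine (hle.trans (mul_le_mul_of_nonneg_left h1 (by positivity))).trans (le_of_eq ?_)
  rw [← pow_mul, show (N + 1) * 2 = 2 * N + 2 by ring, pow_succ 4 (N + 1)]
  ring

theorem exists_isPoly_sq_sub_integral_abs_le (hc : Convex ℝ D) (hK : IsCompact D)
    (h0 : volume D ≠ 0) (ha : ∀ x ∈ D, ContDiffAt ℝ (N + 1 : ℕ) a x) (hh : Metric.diam D ≤ h) :
    ∃ P, IsPoly N P ∧ ∫ x in D, |a x * a x - P x|
      ≤ 4 * 2 ^ (N + 1) * h ^ (N + 1) * ∫ x in D, sobolevDensity (N + 1) a x := by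
  have haa : ∀ x ∈ D, ContDiffAt ℝ (N + 1 : ℕ) (fun y => a y * a y) x :=
    fun x hx => (ha x hx).mul (ha x hx)
  obtain ⟨P, hP, hle⟩ := exists_isPoly_integral_pow_le hc hK h0 haa hh 1
  have hh0 : 0 ≤ h := Metric.diam_nonneg.trans hh
  refine ⟨P, hP, ?_⟩
  simp only [pow_one] at hle
  have h1 : ∫ x in D, ‖iteratedFDeriv ℝ (N + 1) (fun y => a y * a y) x‖
      ≤ ∫ x in D, 2 ^ (N + 1) * sobolevDensity (N + 1) a x :=
    setIntegral_mono_on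
      ((continuousOn_iteratedFDeriv le_rfl haa).norm.integrableOn_compact hK)
      (((continuousOn_sobolevDensity ha).integrableOn_compact hK).const_mul _) hK.measurableSet
      fun x hx => norm_iteratedFDeriv_sq_self_le (ha x hx)
  rw [integral_const_mul] at h1
  refine (hle.trans (mul_le_mul_of_nonneg_left h1 (by positivity))).trans (le_of_eq ?_)
  ring

/-- The residual of the discrete conservation law is uniformly of order `h ^ (N + 1)`. -/
theorem exists_residual_bound (N : ℕ) : ∃ C : ℝ, 0 ≤ C ∧ ∀ v : Fin 3 → Plane,
    AffineIndependent ℝ v → ∀ (r g : Plane → ℝ) (G h : ℝ), IsPoly N r →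
    Metric.diam (convexHull ℝ (range v)) ≤ h →
    (∀ x ∈ convexHull ℝ (range v), ContDiffAt ℝ (N + 1 : ℕ) g x) →
    (∀ x ∈ convexHull ℝ (range v), ∀ j ≤ N + 1, ‖iteratedFDeriv ℝ j g x‖ ≤ G) →
    (∀ p, IsPoly N p → ∫ x in convexHull ℝ (range v), (r x + g x) * p x = 0) →
    ∀ x ∈ convexHull ℝ (range v), |r x + g x| ≤ C * G * h ^ (N + 1) := by
  obtain ⟨C, hC, hbound⟩ := exists_bound_of_orthogonal N
  refine ⟨C + 1, by linarith, fun v hv r g G h hr hh hg hG horth x hx => ?_⟩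
  set D := convexHull ℝ (range v) with hD
  have hK : IsCompact D := isCompact_triangle
  have hc : Convex ℝ D := convex_convexHull ℝ _
  let P := taylorPoly N g x
  have hP : IsPoly N P := isPoly_taylorPoly N g x
  have hgP : ∀ y ∈ D, |g y - P y| ≤ h ^ (N + 1) * G := fun y hy =>
    abs_sub_taylorPoly_le_of_bound hc hg (fun z hz => hG z hz _ le_rfl) hy hx (by
      rw [← dist_eq_norm]
      exact (Metric.dist_le_diam_of_mem hK.isBounded hy hx).trans hh)
  have hgc : ContinuousOn g D := continuousOn_of_contDiffAt hg
  -- By `horth`, the polynomial `r + P` has the same moments as `P - g`, which is already small.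
  -- Stability of the projection bounds it pointwise.
  have h1 := hbound v hv (fun y => r y + P y) (fun y => P y - g y) (h ^ (N + 1) * G) (hr.add hP)
    (fun y hy => by rw [abs_sub_comm]; exact hgP y hy) (fun p hp => by
      rw [← sub_eq_zero, ← integral_sub, ← horth p hp]
      · exact integral_congr_ae (ae_of_all _ fun y => by ring)
      · exact ((hr.add hP).mul hp).integrableOn hK
      · exact ((hP.continuous.continuousOn.sub hgc).mul
          hp.continuous.continuousOn).integrableOn_compact hK) x hx
  have h2 := hgP x hx
  calc |r x + g x| = |(r x + P x) + (g x - P x)| := by ring_nf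
    _ ≤ |r x + P x| + |g x - P x| := abs_add_le _ _
    _ ≤ C * (h ^ (N + 1) * G) + h ^ (N + 1) * G := add_le_add h1 h2
    _ = (C + 1) * G * h ^ (N + 1) := by ring

/-- The `L²` projection is a best approximation, so it is no worse than the polynomial from
`exists_isPoly_sub_integral_sq_le`. -/
theorem integral_sq_le_of_orthogonal {u : Plane → ℝ} (hc : Convex ℝ D) (hK : IsCompact D)
    (h0 : volume D ≠ 0) (ha : ∀ x ∈ D, ContDiffAt ℝ (N + 1 : ℕ) a x) (hu : IsPoly N u)
    (hh : Metric.diam D ≤ h) (horth : ∀ p, IsPoly N p → ∫ x in D, (a x - u x) * p x = 0) :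
    ∫ x in D, (a x - u x) ^ 2 ≤ 4 * h ^ (2 * N + 2) * ∫ x in D, sobolevDensity (N + 1) a x := by
  obtain ⟨P, hP, hle⟩ := exists_isPoly_sub_integral_sq_le hc hK h0 ha hh
  have hac : ContinuousOn a D := continuousOn_of_contDiffAt ha
  have hwc : ContinuousOn (fun x => a x - u x) D := hac.sub hu.continuous.continuousOn
  have hPc : ContinuousOn (fun x => a x - P x) D := hac.sub hP.continuous.continuousOn
  have h1 := horth _ (hP.sub hu)
  have i1 : IntegrableOn (fun x => (a x - u x) ^ 2) D := (hwc.pow 2).integrableOn_compact hK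
  have i2 : IntegrableOn (fun x => (a x - P x) ^ 2) D := (hPc.pow 2).integrableOn_compact hK
  have i3 : IntegrableOn (fun x => (a x - u x) * (P x - u x)) D :=
    (hwc.mul (hP.sub hu).continuous.continuousOn).integrableOn_compact hK
  have h2 : ∫ x in D, (a x - u x) ^ 2
      ≤ ∫ x in D, ((a x - P x) ^ 2 + 2 * ((a x - u x) * (P x - u x))) :=
    setIntegral_mono_on i1 (i2.add (i3.const_mul 2)) hK.measurableSet
      fun x _ => by nlinarith [sq_nonneg (P x - u x)]
  rw [integral_add i2 (i3.const_mul 2), integral_const_mul, h1] at h2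
  linarith

/-- Only `u` is controlled here, so the smoothness is transferred through `J`. With `w = q/J - u`
and `P ∈ P^N` close to `J u`, the polynomial `q - P` equals `J w + (J u - P)`. Testing `w` against
it gives `∫ J w² = -∫ w (J u - P)`, and `J ≥ c` concludes. -/
theorem integral_sq_le_of_weighted_orthogonal {u q J : Plane → ℝ} {c R : ℝ} (hcD : Convex ℝ D)
    (hK : IsCompact D) (h0 : volume D ≠ 0) (hu : IsPoly N u) (hq : IsPoly N q) (hJ : IsPoly N J)
    (hc : 0 < c) (hcJ : ∀ x ∈ D, c ≤ J x)
    (hR : ∀ x ∈ D, ∀ j ≤ N + 1, ‖iteratedFDeriv ℝ j J x‖ ≤ R)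
    (hh : Metric.diam D ≤ h) (horth : ∀ p, IsPoly N p → ∫ x in D, (q x / J x - u x) * p x = 0) :
    ∫ x in D, (q x / J x - u x) ^ 2
      ≤ 4 ^ (N + 2) * R ^ 2 / c ^ 2 * h ^ (2 * N + 2) * ∫ x in D, sobolevDensity (N + 1) u x := by
  obtain ⟨P, hP, hle⟩ := exists_isPoly_mul_sub_integral_sq_le hcD hK h0
    (fun x _ => (hJ.contDiff_nat (N + 1)).contDiffAt) hR
    (fun x _ => (hu.contDiff_nat (N + 1)).contDiffAt) hh
  have hwc : ContinuousOn (fun x => q x / J x - u x) D :=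
    (hq.continuous.continuousOn.div hJ.continuous.continuousOn
      fun x hx => (hc.trans_le (hcJ x hx)).ne').sub hu.continuous.continuousOn
  have hPc : ContinuousOn (fun x => J x * u x - P x) D :=
    ((hJ.mul hu).continuous.sub hP.continuous).continuousOn
  have h1 := horth _ (hq.sub hP)
  have i1 : IntegrableOn (fun x => (q x / J x - u x) ^ 2) D := (hwc.pow 2).integrableOn_compact hK
  have i2 : IntegrableOn (fun x => (J x * u x - P x) ^ 2) D := (hPc.pow 2).integrableOn_compact hK
  have i3 : IntegrableOn (fun x => (q x / J x - u x) * (q x - P x)) D :=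
    (hwc.mul (hq.sub hP).continuous.continuousOn).integrableOn_compact hK
  have h2 : ∫ x in D, c * (q x / J x - u x) ^ 2
      ≤ ∫ x in D, (1 / c * (J x * u x - P x) ^ 2 + 2 * ((q x / J x - u x) * (q x - P x))) := by
    refine setIntegral_mono_on (i1.const_mul c) ((i2.const_mul _).add (i3.const_mul 2))
      hK.measurableSet fun x hx => ?_
    have hJx := hcJ x hx
    have hJpos : 0 < J x := hc.trans_le hJx
    have hw : q x - P x = J x * (q x / J x - u x) + (J x * u x - P x) := by
      field_simp
      ring
    rw [hw]
    generalize q x / J x - u x = w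
    generalize J x * u x - P x = b
    -- Completing the square makes the pointwise inequality a sum of two nonnegative terms.
    have h3 : 1 / c * b ^ 2 + 2 * (w * (J x * w + b)) - c * w ^ 2
        = (b + c * w) ^ 2 / c + 2 * (J x - c) * w ^ 2 := by
      field_simp
      ring
    have h4 : 0 ≤ (b + c * w) ^ 2 / c := by positivity
    have h5 : 0 ≤ 2 * (J x - c) * w ^ 2 :=
      mul_nonneg (mul_nonneg zero_le_two (sub_nonneg.2 hJx)) (sq_nonneg _)
    linarith
  rw [integral_add (i2.const_mul _) (i3.const_mul 2), integral_const_mul, integral_const_mul,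
    integral_const_mul, h1, mul_zero, add_zero] at h2
  have h3 := h2.trans (mul_le_mul_of_nonneg_left hle (by positivity))
  rw [← le_div_iff₀' hc] at h3
  refine h3.trans (le_of_eq ?_)
  field_simp

/-! ### Energy production on one element. -/

/-- Young's inequality distributes each product so that every term is second order: `H` times an
approximation error, `H²` times the density, or a square. The term `e w²` has an extra factor `H`,
which is absorbed by `d`. -/
theorem abs_production_integrand_le {B H d e g a w s p t G α β γ : ℝ} (hB : 0 ≤ B)
    (hHd : H ≤ d) (he : |e| ≤ B * H) (hg : |g| ≤ G) (hs : a ^ 2 ≤ s) (hα : |α| ≤ 2)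
    (hβ : |β| ≤ 2) (hγ : |γ| ≤ 2) :
    |e * p + α * (e * (a * w)) + β * (e * w ^ 2) - 2 * (t * w) - γ * (g * w ^ 2)|
      ≤ B * H * |p| + B * H ^ 2 * s + t ^ 2 + (B + 2 * B * d + 1 + 2 * G) * w ^ 2 := by
  have t1 : |e * p| ≤ B * H * |p| := by
    rw [abs_mul]
    exact mul_le_mul_of_nonneg_right he (abs_nonneg _)
  have t2 : |α * (e * (a * w))| ≤ B * H ^ 2 * s + B * w ^ 2 := by
    rw [abs_mul, abs_mul, abs_mul]
    have s1 : |α| * (|e| * (|a| * |w|)) ≤ 2 * (B * H * (|a| * |w|)) := by gcongr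
    have s2 : 2 * (H * |a| * |w|) ≤ H ^ 2 * a ^ 2 + w ^ 2 := by
      have := two_mul_le_add_sq (H * |a|) |w|
      rw [mul_pow, sq_abs, sq_abs] at this
      linarith
    have s3 : B * (H ^ 2 * a ^ 2) ≤ B * (H ^ 2 * s) := by gcongr
    have s4 := mul_le_mul_of_nonneg_left s2 hB
    linarith
  have t3 : |β * (e * w ^ 2)| ≤ 2 * B * d * w ^ 2 := by
    rw [abs_mul, abs_mul, abs_of_nonneg (sq_nonneg w)]
    have s1 : |e| ≤ B * d := he.trans (by gcongr)
    have s2 : |β| * (|e| * w ^ 2) ≤ 2 * (B * d * w ^ 2) := by gcongr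
    linarith
  have t4 : |2 * (t * w)| ≤ t ^ 2 + w ^ 2 := by
    rw [abs_le]
    constructor <;> nlinarith [sq_nonneg (t - w), sq_nonneg (t + w)]
  have t5 : |γ * (g * w ^ 2)| ≤ 2 * G * w ^ 2 := by
    rw [abs_mul, abs_mul, abs_of_nonneg (sq_nonneg w)]
    have s1 : |γ| * (|g| * w ^ 2) ≤ 2 * (G * w ^ 2) := by gcongr
    linarith
  have t6 : |e * p + α * (e * (a * w)) + β * (e * w ^ 2) - 2 * (t * w) - γ * (g * w ^ 2)|
      ≤ |e * p| + |α * (e * (a * w))| + |β * (e * w ^ 2)| + |2 * (t * w)|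
        + |γ * (g * w ^ 2)| :=
    (abs_sub _ _).trans (add_le_add ((abs_sub _ _).trans (add_le_add
      ((abs_add_le _ _).trans (add_le_add (abs_add_le _ _) le_rfl)) le_rfl)) le_rfl)
  linarith

/-- Bound of the energy production on one element. -/
theorem abs_integral_production_le (hcD : Convex ℝ D) (hK : IsCompact D) (h0 : volume D ≠ 0)
    (hh : Metric.diam D ≤ h) {r : Plane → ℝ} {G B W d α β γ : ℝ} (hr : IsPoly N r) (hhd : h ≤ d)
    (hg : ∀ x ∈ D, ContDiffAt ℝ (N + 1 : ℕ) g x)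
    (hG : ∀ x ∈ D, ∀ j ≤ N + 1, ‖iteratedFDeriv ℝ j g x‖ ≤ G)
    (hB : 0 ≤ B) (hrg : ∀ x ∈ D, |r x + g x| ≤ B * h ^ (N + 1))
    (hrorth : ∀ p, IsPoly N p → ∫ x in D, (r x + g x) * p x = 0)
    (ha : ∀ x ∈ D, ContDiffAt ℝ (N + 1 : ℕ) a x) (hw : ContinuousOn w D)
    (hworth : ∀ p, IsPoly N p → ∫ x in D, w x * p x = 0)
    (hW : ∫ x in D, w x ^ 2 ≤ W * h ^ (2 * N + 2) * ∫ x in D, sobolevDensity (N + 1) a x)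
    (hα : |α| ≤ 2) (hβ : |β| ≤ 2) (hγ : |γ| ≤ 2) :
    |∫ x in D, ((r x + g x) * (a x ^ 2 + α * (a x * w x) + β * w x ^ 2)
        - g x * (2 * (a x * w x) + γ * w x ^ 2))|
      ≤ (4 * 2 ^ (N + 1) * B + B + 4 ^ (N + 2) * G ^ 2
          + (B + 2 * B * d ^ (N + 1) + 1 + 2 * |G|) * W)
        * h ^ (2 * N + 2) * ∫ x in D, sobolevDensity (N + 1) a x := by
  have hh0 : 0 ≤ h := Metric.diam_nonneg.trans hh
  set H := h ^ (N + 1) with hHdef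
  have hH0 : 0 ≤ H := by positivity
  have hH2 : h ^ (2 * N + 2) = H ^ 2 := by rw [hHdef, ← pow_mul]; ring_nf
  have hHd : H ≤ d ^ (N + 1) := pow_le_pow_left₀ hh0 hhd _
  rw [hH2] at hW ⊢
  obtain ⟨P, hP, hPle⟩ := exists_isPoly_sq_sub_integral_abs_le hcD hK h0 ha hh
  obtain ⟨Q, hQ, hQle⟩ := exists_isPoly_mul_sub_integral_sq_le hcD hK h0 hg hG ha hh
  rw [hH2] at hQle
  rw [← hHdef] at hPle
  set S := ∫ x in D, sobolevDensity (N + 1) a x with hS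
  have hac : ContinuousOn a D := continuousOn_of_contDiffAt ha
  have hgc : ContinuousOn g D := continuousOn_of_contDiffAt hg
  have hec : ContinuousOn (fun x => r x + g x) D := hr.continuous.continuousOn.add hgc
  have hPc : ContinuousOn P D := hP.continuous.continuousOn
  have hQc : ContinuousOn Q D := hQ.continuous.continuousOn
  -- `F` is the integrand with `e P` subtracted and `2 w Q` added. Both corrections integrate to
  -- zero by orthogonality, and the remaining differences are approximation errors.
  let F : Plane → ℝ := fun x => (r x + g x) * (a x * a x - P x)
    + α * ((r x + g x) * (a x * w x)) + β * ((r x + g x) * w x ^ 2)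
    - 2 * ((g x * a x - Q x) * w x) - γ * (g x * w x ^ 2)
  have hFc : ContinuousOn F D := by fun_prop
  have iF : IntegrableOn F D := hFc.integrableOn_compact hK
  have i1 : IntegrableOn (fun x => (r x + g x) * P x) D :=
    (hec.mul hPc).integrableOn_compact hK
  have i2 : IntegrableOn (fun x => w x * Q x) D := (hw.mul hQc).integrableOn_compact hK
  have heq : ∫ x in D, ((r x + g x) * (a x ^ 2 + α * (a x * w x) + β * w x ^ 2)
        - g x * (2 * (a x * w x) + γ * w x ^ 2)) = ∫ x in D, F x := by
    have h1 : ∫ x in D, ((r x + g x) * (a x ^ 2 + α * (a x * w x) + β * w x ^ 2)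
        - g x * (2 * (a x * w x) + γ * w x ^ 2))
        = ∫ x in D, (F x + (r x + g x) * P x - 2 * (w x * Q x)) :=
      integral_congr_ae (ae_of_all _ fun x => by simp only [F]; ring)
    have i3 : IntegrableOn (fun x => F x + (r x + g x) * P x) D := iF.add i1
    rw [h1, integral_sub i3 (i2.const_mul 2), integral_add iF i1, integral_const_mul,
      hrorth P hP, hworth Q hQ]
    ring
  rw [heq]
  have j1 : IntegrableOn (fun x => |a x * a x - P x|) D :=
    ((hac.mul hac).sub hPc).abs.integrableOn_compact hK
  have j2 : IntegrableOn (sobolevDensity (N + 1) a) D :=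
    (continuousOn_sobolevDensity ha).integrableOn_compact hK
  have j3 : IntegrableOn (fun x => w x ^ 2) D := (hw.pow 2).integrableOn_compact hK
  have j4 : IntegrableOn (fun x => (g x * a x - Q x) ^ 2) D :=
    (((hgc.mul hac).sub hQc).pow 2).integrableOn_compact hK
  set κ := B + 2 * B * d ^ (N + 1) + 1 + 2 * |G| with hκ
  have hd0 : 0 ≤ d := hh0.trans hhd
  have hκ0 : 0 ≤ κ := by positivity
  have hpt : ∀ x ∈ D, |F x| ≤ B * H * |a x * a x - P x| + B * H ^ 2 * sobolevDensity (N + 1) a x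
      + (g x * a x - Q x) ^ 2 + κ * w x ^ 2 := by
    intro x hx
    refine abs_production_integrand_le hB hHd (hrg x hx) ?_ sq_le_sobolevDensity hα hβ hγ
    have := hG x hx 0 (Nat.zero_le _)
    rw [norm_iteratedFDeriv_zero] at this
    exact this.trans (le_abs_self G)
  have j5 : IntegrableOn (fun x => B * H * |a x * a x - P x|
      + B * H ^ 2 * sobolevDensity (N + 1) a x) D := (j1.const_mul _).add (j2.const_mul _)
  have j6 : IntegrableOn (fun x => B * H * |a x * a x - P x|
      + B * H ^ 2 * sobolevDensity (N + 1) a x + (g x * a x - Q x) ^ 2) D := j5.add j4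
  have hint : |∫ x in D, F x| ≤ ∫ x in D, (B * H * |a x * a x - P x|
      + B * H ^ 2 * sobolevDensity (N + 1) a x + (g x * a x - Q x) ^ 2 + κ * w x ^ 2) :=
    (abs_integral_le_integral_abs).trans (setIntegral_mono_on iF.abs
      (j6.add (j3.const_mul _)) hK.measurableSet hpt)
  rw [integral_add j6 (j3.const_mul _), integral_add j5 j4,
    integral_add (j1.const_mul _) (j2.const_mul _), integral_const_mul, integral_const_mul,
    integral_const_mul, ← hS] at hint
  have k1 := mul_le_mul_of_nonneg_left hPle (mul_nonneg hB hH0)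
  have k2 := mul_le_mul_of_nonneg_left hW hκ0
  refine (hint.trans (add_le_add (add_le_add (add_le_add k1 le_rfl) hQle) k2)).trans
    (le_of_eq ?_)
  ring

end Element

/-! ### The energy estimate -/

namespace Triangulation

variable {Ω : Set Plane} (𝒯 : Triangulation Ω)

theorem isCompact_elem (k : Fin 𝒯.K) : IsCompact (𝒯.elem k) := isCompact_triangle

theorem convex_elem (k : Fin 𝒯.K) : Convex ℝ (𝒯.elem k) := convex_convexHull ℝ _

theorem volume_elem_ne_zero (k : Fin 𝒯.K) : volume (𝒯.elem k) ≠ 0 :=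
  volume_triangle_ne_zero (𝒯.nondegenerate k)

theorem elem_subset (k : Fin 𝒯.K) : 𝒯.elem k ⊆ Ω :=
  (subset_iUnion 𝒯.elem k).trans 𝒯.covers.subset

theorem isCompact_domain (𝒯 : Triangulation Ω) : IsCompact Ω := by
  have h : IsCompact (⋃ k, 𝒯.elem k) := isCompact_iUnion 𝒯.isCompact_elem
  rwa [show (⋃ k, 𝒯.elem k) = Ω from 𝒯.covers] at h

theorem diam_elem_le_size (k : Fin 𝒯.K) : Metric.diam (𝒯.elem k) ≤ 𝒯.size :=
  le_ciSup (f := fun k => Metric.diam (𝒯.elem k)) (finite_range _).bddAbove k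

theorem size_nonneg : 0 ≤ 𝒯.size := Real.iSup_nonneg fun _ => Metric.diam_nonneg

theorem size_le_diam : 𝒯.size ≤ Metric.diam Ω :=
  Real.iSup_le (fun k => Metric.diam_mono (𝒯.elem_subset k) 𝒯.isCompact_domain.isBounded)
    Metric.diam_nonneg

theorem sum_integral_sobolevDensity_le {m : ℕ} {f : Fin 𝒯.K → Plane → ℝ} {M : ℝ}
    (hf : ∀ k, ∀ x ∈ 𝒯.elem k, ContDiffAt ℝ m (f k) x) (hM : 𝒯.sobolevNorm m f ≤ M) :
    ∑ k, ∫ x in 𝒯.elem k, sobolevDensity m (f k) x ≤ M ^ 2 := by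
  have h : ∑ k, ∫ x in 𝒯.elem k, sobolevDensity m (f k) x
      = ∑ k, ∑ j ∈ Finset.range (m + 1), ∫ x in 𝒯.elem k, ‖iteratedFDeriv ℝ j (f k) x‖ ^ 2 :=
    Finset.sum_congr rfl fun k _ => integral_finsetSum _ fun j hj =>
      (continuousOn_norm_iteratedFDeriv_pow (Nat.lt_succ_iff.1 (Finset.mem_range.1 hj)) 2
        (hf k)).integrableOn_compact (𝒯.isCompact_elem k)
  rw [h]
  exact (Real.sqrt_le_left ((Real.sqrt_nonneg _).trans hM)).1 hM

end Triangulation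

namespace IsWADGSolution

variable {Ω : Set Plane} {𝒯 : Triangulation Ω} {N : ℕ} {X : ℝ → Plane → Plane} {T : ℝ}
  {q J u : Fin 𝒯.K → ℝ → Plane → ℝ} {uext : Fin 𝒯.K → Fin 3 → ℝ → Plane → ℝ}

theorem continuousOn_quotient (hs : IsWADGSolution 𝒯 N X T q J u uext) (k : Fin 𝒯.K) {t : ℝ}
    (ht : t ∈ Icc 0 T) : ContinuousOn (fun x => q k t x / J k t x) (𝒯.elem k) :=
  (hs.poly_q k t ht).continuous.continuousOn.div (hs.poly_J k t ht).continuous.continuousOn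
    fun x hx => (hs.J_pos k t ht x hx).ne'

theorem contDiffAt_quotient (hs : IsWADGSolution 𝒯 N X T q J u uext) (n : ℕ) (k : Fin 𝒯.K)
    {t : ℝ} (ht : t ∈ Icc 0 T) {x : Plane} (hx : x ∈ 𝒯.elem k) :
    ContDiffAt ℝ n (fun x => q k t x / J k t x) x :=
  ((hs.poly_q k t ht).contDiff_nat n).contDiffAt.div
    ((hs.poly_J k t ht).contDiff_nat n).contDiffAt (hs.J_pos k t ht x hx).ne'

theorem orthogonal (hs : IsWADGSolution 𝒯 N X T q J u uext) (k : Fin 𝒯.K) {t : ℝ}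
    (ht : t ∈ Icc 0 T) {p : Plane → ℝ} (hp : IsPoly N p) :
    ∫ x in 𝒯.elem k, (q k t x / J k t x - u k t x) * p x = 0 := by
  have hK := 𝒯.isCompact_elem k
  have h := hs.projection k t ht p hp
  simp only [sub_mul]
  rw [integral_sub, h, sub_self]
  · exact ((hs.continuousOn_quotient k ht).mul hp.continuous.continuousOn).integrableOn_compact hK
  · exact ((hs.poly_u k t ht).mul hp).integrableOn hK

theorem continuousOn_energy (hs : IsWADGSolution 𝒯 N X T q J u uext) (hT : 0 ≤ T) :
    ContinuousOn (fun t => 𝒯.energy (fun k => q k t) fun k => J k t) (Icc 0 T) :=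
  continuousOn_finsetSum _ fun k _ => continuousOn_integral_energyDensity hT (𝒯.isCompact_elem k)
    (hs.poly_q k) (hs.poly_J k) (hs.J_pos k) (hs.continuous_q k) (hs.continuous_J k)

theorem hasDerivAt_energy (hs : IsWADGSolution 𝒯 N X T q J u uext) {t : ℝ} (ht : t ∈ Ioo 0 T)
    (hg : ∀ x ∈ Ω, ContinuousAt (divergence (meshFlux X t)) x) :
    HasDerivAt (fun t => 𝒯.energy (fun k => q k t) fun k => J k t)
      (-∑ k, ∫ x in 𝒯.elem k,
        ((deriv (fun s => J k s x) t + divergence (meshFlux X t) x) * (q k t x / J k t x) ^ 2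
          - divergence (meshFlux X t) x * ((q k t x / J k t x) ^ 2 - u k t x ^ 2))) t := by
  have htI := Ioo_subset_Icc_self ht
  have hder : HasDerivAt (fun t => 𝒯.energy (fun k => q k t) fun k => J k t)
      (∑ k, ∫ x in 𝒯.elem k, (2 * (q k t x / J k t x * deriv (fun s => q k s x) t)
        - (q k t x / J k t x) ^ 2 * deriv (fun s => J k s x) t)) t :=
    HasDerivAt.fun_sum fun k _ => hasDerivAt_integral_energyDensity (𝒯.isCompact_elem k)
      (hs.poly_q k) (hs.poly_J k) (hs.J_pos k) (hs.continuous_q k) (hs.continuous_J k)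
      (hs.differentiable_q k) (hs.differentiable_J k) ht
  refine hder.congr_deriv ?_
  have hedge := 𝒯.sum_edgeIntegral_flux_eq_zero (meshFlux X t) (fun k => u k t)
    (fun k i => uext k i t) (fun k i l hl => hs.trace_interior k i t ht l hl)
    (fun k i hno => hs.boundary k i t ht hno)
  have hk : ∀ k, ∫ x in 𝒯.elem k, (2 * (q k t x / J k t x * deriv (fun s => q k s x) t)
        - (q k t x / J k t x) ^ 2 * deriv (fun s => J k s x) t)
      = -(∫ x in 𝒯.elem k,
        ((deriv (fun s => J k s x) t + divergence (meshFlux X t) x) * (q k t x / J k t x) ^ 2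
          - divergence (meshFlux X t) x * ((q k t x / J k t x) ^ 2 - u k t x ^ 2)))
        - ∑ i, 𝒯.edgeIntegral k i
          (fun x => uext k i t x * inner ℝ (meshFlux X t x) (𝒯.normal k i) * u k t x) := by
    intro k
    have hK := 𝒯.isCompact_elem k
    have hu := hs.poly_u k t htI
    have hq' := isPoly_deriv (hs.poly_q k) (hs.differentiable_q k) ht
    have hJ' := isPoly_deriv (hs.poly_J k) (hs.differentiable_J k) ht
    have hqJ := hs.continuousOn_quotient k htI
    have hgc : ContinuousOn (divergence (meshFlux X t)) (𝒯.elem k) := fun x hx =>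
      (hg x (𝒯.elem_subset k hx)).continuousWithinAt
    -- With `v = u` the two transport terms are equal and cancel. The projection identity `h2`,
    -- tested with `∂q/∂τ`, then brings in `q / J`.
    have h1 := hs.eq_q k t ht _ hu
    have h2 := hs.projection k t htI _ hq'
    have h3 : ∫ x in 𝒯.elem k, inner ℝ (meshFlux X t x) (gradient (u k t) x) * u k t x
        = ∫ x in 𝒯.elem k, u k t x * inner ℝ (meshFlux X t x) (gradient (u k t) x) :=
      integral_congr_ae (ae_of_all _ fun x => mul_comm _ _)
    have h4 : ∫ x in 𝒯.elem k, deriv (fun s => q k s x) t * u k t x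
        = ∫ x in 𝒯.elem k, u k t x * deriv (fun s => q k s x) t :=
      integral_congr_ae (ae_of_all _ fun x => mul_comm _ _)
    rw [h3, add_sub_cancel_right, h4, h2] at h1
    have i1 : IntegrableOn (fun x => q k t x / J k t x * deriv (fun s => q k s x) t)
        (𝒯.elem k) := (hqJ.mul hq'.continuous.continuousOn).integrableOn_compact hK
    have i2 : IntegrableOn (fun x => (q k t x / J k t x) ^ 2 * deriv (fun s => J k s x) t)
        (𝒯.elem k) := ((hqJ.pow 2).mul hJ'.continuous.continuousOn).integrableOn_compact hK
    have i3 : IntegrableOn (fun x => divergence (meshFlux X t) x * u k t x * u k t x)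
        (𝒯.elem k) := ((hgc.mul hu.continuous.continuousOn).mul
          hu.continuous.continuousOn).integrableOn_compact hK
    have h5 : ∫ x in 𝒯.elem k,
        ((deriv (fun s => J k s x) t + divergence (meshFlux X t) x) * (q k t x / J k t x) ^ 2
          - divergence (meshFlux X t) x * ((q k t x / J k t x) ^ 2 - u k t x ^ 2))
        = (∫ x in 𝒯.elem k, (q k t x / J k t x) ^ 2 * deriv (fun s => J k s x) t)
          + ∫ x in 𝒯.elem k, divergence (meshFlux X t) x * u k t x * u k t x := by
      rw [← integral_add i2 i3]
      exact integral_congr_ae (ae_of_all _ fun x => by ring)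
    rw [h5, integral_sub (i1.const_mul 2) i2, integral_const_mul]
    linarith
  rw [Finset.sum_congr rfl fun k _ => hk k, Finset.sum_sub_distrib, hedge, sub_zero,
    Finset.sum_neg_distrib]

/-- The energy defect is bounded by the squared broken Sobolev norm of a function `a` from which
`u` and `q / J` deviate by `O(h ^ (N + 1))`. -/
theorem abs_energy_sub_le (hs : IsWADGSolution 𝒯 N X T q J u uext) (hT : 0 ≤ T)
    {C : ℝ} (hC : 0 ≤ C) {M : ℝ} {a : Fin 𝒯.K → ℝ → Plane → ℝ}
    (hg : ∀ t ∈ Ioo 0 T, ∀ x ∈ Ω, ContinuousAt (divergence (meshFlux X t)) x)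
    (ha : ∀ k, ∀ t ∈ Icc 0 T, ∀ x ∈ 𝒯.elem k, ContDiffAt ℝ (N + 1 : ℕ) (a k t) x)
    (hM : ∀ t ∈ Icc 0 T, 𝒯.sobolevNorm (N + 1) (a · t) ≤ M)
    (hbound : ∀ k, ∀ t ∈ Ioo 0 T, |∫ x in 𝒯.elem k,
        ((deriv (fun s => J k s x) t + divergence (meshFlux X t) x) * (q k t x / J k t x) ^ 2
          - divergence (meshFlux X t) x * ((q k t x / J k t x) ^ 2 - u k t x ^ 2))|
      ≤ C * 𝒯.size ^ (2 * N + 2) * ∫ x in 𝒯.elem k, sobolevDensity (N + 1) (a k t) x) :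
    |𝒯.energy (fun k => q k T) (fun k => J k T) - 𝒯.energy (fun k => q k 0) (fun k => J k 0)|
      ≤ T * C * M ^ 2 * 𝒯.size ^ (2 * N + 2) := by
  have hsize := 𝒯.size_nonneg
  rcases hT.eq_or_lt with rfl | hT'
  · simp
  -- The mean value theorem needs the derivative bound at a single interior time only, so
  -- integrability of the derivative in time plays no role.
  obtain ⟨t, ht, hslope⟩ := exists_hasDerivAt_eq_slope
    (fun t => 𝒯.energy (fun k => q k t) fun k => J k t) _ hT' (hs.continuousOn_energy hT)
    fun t ht => hs.hasDerivAt_energy ht (hg t ht)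
  rw [sub_zero, eq_div_iff hT'.ne'] at hslope
  rw [← hslope, abs_mul, abs_neg, abs_of_pos hT']
  have hsum := 𝒯.sum_integral_sobolevDensity_le (fun k => ha k t (Ioo_subset_Icc_self ht))
    (hM t (Ioo_subset_Icc_self ht))
  have h1 := (Finset.abs_sum_le_sum_abs _ _).trans
    (Finset.sum_le_sum fun k (_ : k ∈ Finset.univ) => hbound k t ht)
  rw [← Finset.mul_sum] at h1
  have h2 := h1.trans (mul_le_mul_of_nonneg_left hsum (by positivity))
  refine (mul_le_mul_of_nonneg_right h2 hT).trans (le_of_eq ?_)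
  ring

end IsWADGSolution

theorem exists_bound_divergence_meshFlux {N : ℕ} {T : ℝ} {Ω : Set Plane} {X : ℝ → Plane → Plane}
    {U : Set (ℝ × Plane)} (hΩ : IsCompact Ω) (hU : IsOpen U) (hΩU : Icc 0 T ×ˢ Ω ⊆ U)
    (hX : ContDiffOn ℝ (N + 3 : ℕ) (fun p : ℝ × Plane => X p.1 p.2) U)
    (hJ : ∀ t ∈ Icc 0 T, ∀ x ∈ Ω, 0 < jacobian X t x) :
    ∃ G : ℝ, ∀ t ∈ Icc 0 T, ∀ x ∈ Ω,
      ContDiffAt ℝ (N + 1 : ℕ) (divergence (meshFlux X t)) x ∧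
      ∀ j ≤ N + 1, ‖iteratedFDeriv ℝ j (divergence (meshFlux X t)) x‖ ≤ G := by
  obtain ⟨G, hG⟩ := exists_bound_iteratedFDeriv_slice (n := N + 1)
    (g := fun t => divergence (meshFlux X t)) (isCompact_Icc.prod hΩ) fun p hp =>
      contDiffAt_divergence_meshFlux (hX.contDiffAt (hU.mem_nhds (hΩU hp)))
        (hJ p.1 hp.1 p.2 hp.2).ne'
  exact ⟨G, fun t ht x hx => hG (t, x) (mk_mem_prod ht hx)⟩

/-- Given control of `q / J - u` in terms of a function `a`, the energy defect is of order
`h ^ (2 * N + 2)`, with a constant independent of the triangulation and of the solution. -/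
theorem exists_energy_bound {N : ℕ} {T : ℝ} (hT : 0 ≤ T) {Ω : Set Plane} {X : ℝ → Plane → Plane}
    {U : Set (ℝ × Plane)} (hΩ : IsCompact Ω) (hU : IsOpen U) (hΩU : Icc 0 T ×ˢ Ω ⊆ U)
    (hX : ContDiffOn ℝ (N + 3 : ℕ) (fun p : ℝ × Plane => X p.1 p.2) U)
    (hJ : ∀ t ∈ Icc 0 T, ∀ x ∈ Ω, 0 < jacobian X t x) (M : ℝ) {W α β γ : ℝ} (hW : 0 ≤ W)
    (hα : |α| ≤ 2) (hβ : |β| ≤ 2) (hγ : |γ| ≤ 2) :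
    ∃ C : ℝ, ∀ (𝒯 : Triangulation Ω) (q J u : Fin 𝒯.K → ℝ → Plane → ℝ)
      (uext : Fin 𝒯.K → Fin 3 → ℝ → Plane → ℝ) (a : Fin 𝒯.K → ℝ → Plane → ℝ),
      IsWADGSolution 𝒯 N X T q J u uext →
      (∀ t ∈ Icc 0 T, 𝒯.sobolevNorm (N + 1) (a · t) ≤ M) →
      (∀ k, ∀ t ∈ Icc 0 T, ∀ x ∈ 𝒯.elem k, ContDiffAt ℝ (N + 1 : ℕ) (a k t) x) →
      (∀ k, ∀ t ∈ Icc 0 T, ∫ x in 𝒯.elem k, (q k t x / J k t x - u k t x) ^ 2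
        ≤ W * 𝒯.size ^ (2 * N + 2) * ∫ x in 𝒯.elem k, sobolevDensity (N + 1) (a k t) x) →
      (∀ k t x, (q k t x / J k t x) ^ 2 = a k t x ^ 2
        + α * (a k t x * (q k t x / J k t x - u k t x)) + β * (q k t x / J k t x - u k t x) ^ 2) →
      (∀ k t x, (q k t x / J k t x) ^ 2 - u k t x ^ 2
        = 2 * (a k t x * (q k t x / J k t x - u k t x))
          + γ * (q k t x / J k t x - u k t x) ^ 2) →
      |𝒯.energy (fun k => q k T) (fun k => J k T) - 𝒯.energy (fun k => q k 0) (fun k => J k 0)|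
        ≤ C * 𝒯.size ^ (2 * N + 2) := by
  obtain ⟨G, hG⟩ := exists_bound_divergence_meshFlux hΩ hU hΩU hX hJ
  obtain ⟨C₀, hC₀, hres⟩ := exists_residual_bound N
  set B := C₀ * |G|
  set d := Metric.diam Ω
  have hd : 0 ≤ d := Metric.diam_nonneg
  have hB : 0 ≤ B := mul_nonneg hC₀ (abs_nonneg _)
  -- The bracket is the constant of `abs_integral_production_le`; `T` comes from the mean value
  -- theorem and `M ^ 2` from summing the densities. Bounding the mesh size by `d = diam Ω` keeps it
  -- independent of the mesh.
  refine ⟨T * (4 * 2 ^ (N + 1) * B + B + 4 ^ (N + 2) * G ^ 2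
    + (B + 2 * B * d ^ (N + 1) + 1 + 2 * |G|) * W) * M ^ 2, ?_⟩
  intro 𝒯 q J u uext a hs hM ha hw hsq hdiff
  refine hs.abs_energy_sub_le hT (by positivity) (fun t ht x hx =>
    (hG t (Ioo_subset_Icc_self ht) x hx).1.continuousAt) ha hM fun k t ht => ?_
  have htI := Ioo_subset_Icc_self ht
  have hK := 𝒯.isCompact_elem k
  have hJ' := isPoly_deriv (hs.poly_J k) (hs.differentiable_J k) ht
  have hg : ∀ x ∈ 𝒯.elem k, ContDiffAt ℝ (N + 1 : ℕ) (divergence (meshFlux X t)) x :=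
    fun x hx => (hG t htI x (𝒯.elem_subset k hx)).1
  have hgb : ∀ x ∈ 𝒯.elem k, ∀ j ≤ N + 1,
      ‖iteratedFDeriv ℝ j (divergence (meshFlux X t)) x‖ ≤ G :=
    fun x hx => (hG t htI x (𝒯.elem_subset k hx)).2
  have hgc := continuousOn_of_contDiffAt hg
  have horth : ∀ p, IsPoly N p → ∫ x in 𝒯.elem k,
      (deriv (fun s => J k s x) t + divergence (meshFlux X t) x) * p x = 0 := by
    intro p hp
    have i1 : IntegrableOn (fun x => divergence (meshFlux X t) x * p x) (𝒯.elem k) :=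
      (hgc.mul hp.continuous.continuousOn).integrableOn_compact hK
    rw [← hs.eq_J k t ht p hp, ← integral_add ((hJ'.mul hp).integrableOn hK) i1]
    exact integral_congr_ae (ae_of_all _ fun x => add_mul _ _ _)
  have hsize := 𝒯.size_nonneg
  have hrb := hres (𝒯.vert k) (𝒯.nondegenerate k) _ _ |G| 𝒯.size hJ' (𝒯.diam_elem_le_size k) hg
    (fun x hx j hj => (hgb x hx j hj).trans (le_abs_self G)) horth
  have hmain := abs_integral_production_le (α := α) (β := β) (γ := γ) (𝒯.convex_elem k) hK
    (𝒯.volume_elem_ne_zero k) (𝒯.diam_elem_le_size k) hJ' 𝒯.size_le_diam hg hgb hB hrb horth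
    (ha k t htI) ((hs.continuousOn_quotient k htI).sub (hs.poly_u k t htI).continuous.continuousOn)
    (fun p hp => hs.orthogonal k htI hp) (hw k t htI) hα hβ hγ
  -- The difference of squares is rewritten first, since `hsq` would otherwise expand the square
  -- inside it.
  simp only [hdiff k t]
  simp only [hsq k t]
  exact hmain

end

end ALEDG

/-! ### The main theorem. -/

open ALEDG
theorem theorem2 (N : ℕ) (T : ℝ) (hT : 0 ≤ T) (Ω : Set Plane) (X : ℝ → Plane → Plane)
    (U : Set (ℝ × Plane)) (hU : IsOpen U) (hΩU : Icc 0 T ×ˢ Ω ⊆ U)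
    (hX : ContDiffOn ℝ (N + 3 : ℕ) (fun p : ℝ × Plane => X p.1 p.2) U)
    (hJ : ∀ t ∈ Icc 0 T, ∀ x ∈ Ω, 0 < jacobian X t x) (M : ℝ) :
    (∃ C : ℝ, ∀ (𝒯 : Triangulation Ω) (q J u : Fin 𝒯.K → ℝ → Plane → ℝ)
      (uext : Fin 𝒯.K → Fin 3 → ℝ → Plane → ℝ),
      IsWADGSolution 𝒯 N X T q J u uext →
      (∀ t ∈ Icc 0 T, 𝒯.sobolevNorm (N + 1) (fun k x => q k t x / J k t x) ≤ M) →
      |𝒯.energy (fun k => q k T) (fun k => J k T) - 𝒯.energy (fun k => q k 0) (fun k => J k 0)|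
        ≤ C * 𝒯.size ^ (2 * N + 2)) ∧
    (∀ c R : ℝ, 0 < c → ∃ C : ℝ, ∀ (𝒯 : Triangulation Ω) (q J u : Fin 𝒯.K → ℝ → Plane → ℝ)
      (uext : Fin 𝒯.K → Fin 3 → ℝ → Plane → ℝ),
      IsWADGSolution 𝒯 N X T q J u uext →
      (∀ k, ∀ t ∈ Icc 0 T, ∀ x ∈ 𝒯.elem k,
        c ≤ J k t x ∧ ∀ j ≤ N + 1, ‖iteratedFDeriv ℝ j (J k t) x‖ ≤ R) →
      (∀ t ∈ Icc 0 T, 𝒯.sobolevNorm (N + 1) (u · t) ≤ M) →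
      |𝒯.energy (fun k => q k T) (fun k => J k T) - 𝒯.energy (fun k => q k 0) (fun k => J k 0)|
        ≤ C * 𝒯.size ^ (2 * N + 2)) := by
  -- A triangulated set is a finite union of triangles, so for noncompact `Ω` there is nothing to
  -- prove.
  by_cases hΩ : IsCompact Ω
  swap
  · exact ⟨⟨0, fun 𝒯 => (hΩ 𝒯.isCompact_domain).elim⟩,
      fun _ _ _ => ⟨0, fun 𝒯 => (hΩ 𝒯.isCompact_domain).elim⟩⟩
  refine ⟨?_, fun c R hc => ?_⟩
  -- Here `a = ũ`, so `ũ² = a²` and `ũ² - u² = 2 a w - w²`.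
  · obtain ⟨C, hC⟩ := exists_energy_bound hT hΩ hU hΩU hX hJ M (W := 4) (α := 0) (β := 0)
      (γ := -1) (by norm_num) (by norm_num) (by norm_num) (by norm_num)
    refine ⟨C, fun 𝒯 q J u uext hs hM => hC 𝒯 q J u uext (fun k t x => q k t x / J k t x) hs hM
      (fun k t ht x hx => hs.contDiffAt_quotient _ k ht hx) (fun k t ht => ?_)
      (fun k t x => by ring) (fun k t x => by ring)⟩
    exact integral_sq_le_of_orthogonal (𝒯.convex_elem k) (𝒯.isCompact_elem k)
      (𝒯.volume_elem_ne_zero k) (fun x hx => hs.contDiffAt_quotient _ k ht hx)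
      (hs.poly_u k t ht) (𝒯.diam_elem_le_size k) fun p hp => hs.orthogonal k ht hp
  -- Here `a = u`, so `ũ = a + w`, `ũ² = a² + 2 a w + w²` and `ũ² - u² = 2 a w + w²`. The value of
  -- `W` is the constant of the weighted projection estimate.
  · obtain ⟨C, hC⟩ := exists_energy_bound hT hΩ hU hΩU hX hJ M
      (W := 4 ^ (N + 2) * R ^ 2 / c ^ 2) (α := 2) (β := 1) (γ := 1) (by positivity)
      (by norm_num) (by norm_num) (by norm_num)
    refine ⟨C, fun 𝒯 q J u uext hs hJb hM => hC 𝒯 q J u uext u hs hM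
      (fun k t ht x _ => ((hs.poly_u k t ht).contDiff_nat (N + 1)).contDiffAt)
      (fun k t ht => ?_) (fun k t x => by ring) (fun k t x => by ring)⟩
    exact integral_sq_le_of_weighted_orthogonal (𝒯.convex_elem k) (𝒯.isCompact_elem k)
      (𝒯.volume_elem_ne_zero k) (hs.poly_u k t ht) (hs.poly_q k t ht) (hs.poly_J k t ht) hc
      (fun x hx => (hJb k t ht x hx).1) (fun x hx => (hJb k t ht x hx).2)
      (𝒯.diam_elem_le_size k) fun p hp => hs.orthogonal k ht hp
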